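/- **Error of the ideal enriched correction.** Let $d\ge 1$, $k\ge 1$, $p=k-1$ and $\alpha>0$. There is a constant $C>0$ that depends only on $d$, $k$ and $\alpha$ such that the following holds. *Setting.* Let $\Omega\subset\mathbb R^d$ be open and bounded, $T>0$, and let $A$ be a measurable coefficient with $\alpha\le A\le\beta$ a.e. in $\Omega$ for some $\beta<\infty$. Write $(\cdot,\cdot)$ and $\|\cdot\|$ for the inner product and norm of $L^2(\Omega)$ and $a(v,w)=(A\nabla v,\nabla w)$. Let $\mathcal T_H$ be a decomposition of $\Omega$ into finitely many $d$-rectangles $\prod_i[a_i,b_i]$ with disjoint interiors contained in $\Omega$, with largest diameter $H$. Let $H^k(\mathcal T_H)$ be the space of all $v\in L^2(\Omega)$ with $v|_K\in H^k(K)$ for every $K\in\mathcal T_H$, with $\|v\|_{H^k(\mathcal T_H)}^2=\sum_K\|v\|_{H^k(K)}^2$. *Spaces and operators.* Let $V_H$ be the space of functions that are on each element a polynomial of partial degree at most $p$, let $\Pi$ be the $L^2$-projection onto $V_H$, and $W=\{w\in H^1_0(\Omega):\Pi w=0\}$. Let $\mathcal B\colon V_H\to H^1_0(\Omega)$ be a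 bubble operator: a linear map which sends each $v\in V_H$ supported in one element $K$ to a function in $H^1_0(K)$ with the same $L^2$-projection onto $V_H$. Let $\mathcal I=\mathcal E\circ\pi_H$, where $\pi_H$ is the $L^2$-projection onto piecewise constants and $\mathcal E$ is a linear (averaging) operator from piecewise constants to the functions in $H^1_0(\Omega)$ that are continuous on $\overline\Omega$ and on each element polynomials of partial degree at most one. Put $\mathcal X v=\mathcal I v+\mathcal B\,\Pi(v-\mathcal I v)$ and $U_H=\mathcal X V_H$. The correction operator is $\mathcal C=\sum_{K\in\mathcal T_H}\mathcal C_K$, where $\mathcal C_Kv\in W$ satisfies $a(\mathcal C_Kv,w)=(A\nabla v,\nabla w)_{L^2(K)}$ for all $w\in W$. The multiscale space is $\widetilde V_H=(1-\mathcal C)U_H$; the projection $\widetilde P v\in\widetilde V_H$ of $v\in H^1_0(\Omega)$ satisfies $a(\widetilde P v,z)=a(v,z)$ for all $z\in\widetilde V_H$. For $F\in H^{-1}(\Omega)$ (in particular for $F\in L^2(\Omega)$, identified with $w\mapsto(F,w)$) the enriched correction $\mathcal DF\in W$ satisfies $a(\mathcal DF,w)=-\langle F,w\rangle$ for all $w\in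 W$. *Solution.* Let $u_0\in H^1_0(\Omega)$, $f\in C([0,T];H^k(\mathcal T_H))$, and let $u\colon[0,T]\to H^1_0(\Omega)$ be a solution of $$\langle\partial_tu(t),v\rangle+a(u(t),v)=(f(t),v)\quad\text{for all }v\in H^1_0(\Omega),\ t\in[0,T],\qquad u(0)=u_0,$$ where $u$ is differentiable on $[0,T]$ as a function with values in $H^{-1}(\Omega)$. *Claim.* For all $t\in[0,T]$, the functions $\widetilde P u(t)$ and $\mathcal D(\partial_tu(t))$ exist and are unique, and $$\sup_{t\in[0,T]}\big\|\nabla\big(u(t)-(\widetilde P u(t)+\mathcal D(\partial_tu(t)))\big)\big\|\le C\,H^{p+2}\sup_{t\in[0,T]}\|f(t)\|_{H^k(\mathcal T_H)}.$$ -/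

import Mathlib

open MeasureTheory Set
open scoped ContDiff

noncomputable section

namespace MultiscaleHeat

variable {d : ℕ}

/-! ### Lebesgue and Sobolev spaces

Points of `ℝ^d` are functions `Fin d → ℝ`; the measure is Lebesgue measure. -/

/-- The Lebesgue space `L²(Ω)`. -/
abbrev L2 (Ω : Set (Fin d → ℝ)) : Type :=
  Lp ℝ 2 ((volume : Measure (Fin d → ℝ)).restrict Ω)

/-- The partial derivative `∂φ/∂x_i`. -/
def pderiv (i : Fin d) (φ : (Fin d → ℝ) → ℝ) (x : Fin d → ℝ) : ℝ :=
  fderiv ℝ φ x (Pi.single i 1)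

/-- `φ ∈ C_c^∞(U)`. -/
structure IsTestFun (U : Set (Fin d → ℝ)) (φ : (Fin d → ℝ) → ℝ) : Prop where
  smooth : ContDiff ℝ ∞ φ
  compact : HasCompactSupport φ
  supp : tsupport φ ⊆ U

theorem IsTestFun.zero (U : Set (Fin d → ℝ)) : IsTestFun U (fun _ => 0) where
  smooth := contDiff_const
  compact := HasCompactSupport.zero
  supp := by
    have h : tsupport (fun _ : Fin d → ℝ => (0 : ℝ)) = ∅ := tsupport_eq_empty_iff.2 rfl
    simp [h]

theorem IsTestFun.add {U : Set (Fin d → ℝ)} {φ ψ : (Fin d → ℝ) → ℝ}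
    (hφ : IsTestFun U φ) (hψ : IsTestFun U ψ) : IsTestFun U (fun x => φ x + ψ x) where
  smooth := hφ.smooth.add hψ.smooth
  compact := hφ.compact.add hψ.compact
  supp := (tsupport_add φ ψ).trans (union_subset hφ.supp hψ.supp)

theorem IsTestFun.const_mul {U : Set (Fin d → ℝ)} {φ : (Fin d → ℝ) → ℝ}
    (hφ : IsTestFun U φ) (c : ℝ) : IsTestFun U (fun x => c * φ x) where
  smooth := contDiff_const.mul hφ.smooth
  compact := hφ.compact.mul_left
  supp := (tsupport_mul_subset_right (f := fun _ => c) (g := φ)).trans hφ.supp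

/-- Tuples `(v, g_1, …, g_d)` of functions in `L²(Ω)`: a Sobolev function together with its
gradient. The norm is the norm `(‖v‖² + ‖∇v‖²)^{1/2}` of `H¹(Ω)`. -/
abbrev GradPair (Ω : Set (Fin d → ℝ)) : Type :=
  PiLp 2 (fun _ : Option (Fin d) => L2 Ω)

/-- The tuples `(φ, ∇φ)` with `φ ∈ C_c^∞(U)`. -/
def testPairs (Ω U : Set (Fin d → ℝ)) : Submodule ℝ (GradPair Ω) where
  carrier := {w | ∃ φ : (Fin d → ℝ) → ℝ, IsTestFun U φ ∧
    (w none =ᵐ[volume.restrict Ω] φ) ∧ ∀ i, (w (some i) =ᵐ[volume.restrict Ω] pderiv i φ)}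
  zero_mem' := by
    refine ⟨fun _ => 0, IsTestFun.zero U, ?_, fun i => ?_⟩
    · exact Lp.coeFn_zero ℝ 2 _
    · have h : pderiv i (fun _ : Fin d → ℝ => (0 : ℝ)) = fun _ => 0 := by
        funext x; simp [pderiv]
      rw [h]; exact Lp.coeFn_zero ℝ 2 _
  add_mem' := by
    rintro w z ⟨φ, hφ, h0, h1⟩ ⟨ψ, hψ, k0, k1⟩
    refine ⟨fun x => φ x + ψ x, hφ.add hψ, ?_, fun i => ?_⟩
    · filter_upwards [Lp.coeFn_add (w none) (z none), h0, k0] with x hx h k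
      rw [PiLp.add_apply, hx, Pi.add_apply, h, k]
    · filter_upwards [Lp.coeFn_add (w (some i)) (z (some i)), h1 i, k1 i] with x hx h k
      rw [PiLp.add_apply, hx, Pi.add_apply, h, k]
      have hd1 := (hφ.smooth.differentiable (by simp)) x
      have hd2 := (hψ.smooth.differentiable (by simp)) x
      simp only [pderiv]
      rw [fderiv_fun_add hd1 hd2]; rfl
  smul_mem' := by
    rintro c w ⟨φ, hφ, h0, h1⟩
    refine ⟨fun x => c * φ x, hφ.const_mul c, ?_, fun i => ?_⟩
    · filter_upwards [Lp.coeFn_smul c (w none), h0] with x hx h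
      rw [PiLp.smul_apply, hx, Pi.smul_apply, h, smul_eq_mul]
    · filter_upwards [Lp.coeFn_smul c (w (some i)), h1 i] with x hx h
      rw [PiLp.smul_apply, hx, Pi.smul_apply, h, smul_eq_mul]
      have hd1 := (hφ.smooth.differentiable (by simp)) x
      simp only [pderiv]
      rw [fderiv_const_mul hd1]; rfl

/-- For `U ⊆ Ω`, the space `H¹₀(U)`, extended by zero to `Ω`: the closure of `C_c^∞(U)` in the
norm of `H¹`. -/
def sobolevZero (Ω U : Set (Fin d → ℝ)) : Submodule ℝ (GradPair Ω) :=
  (testPairs Ω U).topologicalClosure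

/-- The Hilbert space `H¹₀(Ω)`. -/
abbrev H10 (Ω : Set (Fin d → ℝ)) : Type := ↥(sobolevZero Ω Ω)

variable {Ω : Set (Fin d → ℝ)}

/-- The embedding `H¹₀(Ω) → L²(Ω)`. -/
def toL2 : H10 Ω →L[ℝ] L2 Ω :=
  (PiLp.proj 2 (fun _ : Option (Fin d) => L2 Ω) none).comp (sobolevZero Ω Ω).subtypeL

/-- The weak partial derivative `∂_i u ∈ L²(Ω)` of `u ∈ H¹₀(Ω)`. -/
def grad (i : Fin d) (u : H10 Ω) : L2 Ω := (u : GradPair Ω) (some i)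

/-- The norm `‖∇u‖` in `L²(Ω)`. -/
def gradNorm (u : H10 Ω) : ℝ := Real.sqrt (∑ i, ‖grad i u‖ ^ 2)

/-- The dual space `H⁻¹(Ω)` of `H¹₀(Ω)`. -/
abbrev HMinusOne (Ω : Set (Fin d → ℝ)) : Type := StrongDual ℝ (H10 Ω)

/-- The embedding `L²(Ω) → H⁻¹(Ω)`, `v ↦ (w ↦ (v, w))`. -/
def toDual (v : L2 Ω) : HMinusOne Ω := (innerSL ℝ v).comp toL2

/-- `h` is the weak partial derivative `∂_i g` on the open set `U`. -/
def IsWeakPDeriv (U : Set (Fin d → ℝ)) (i : Fin d) (g h : (Fin d → ℝ) → ℝ) : Prop :=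
  ∀ φ, IsTestFun U φ → (∫ x in U, g x * pderiv i φ x) = -(∫ x in U, h x * φ x)

/-! ### Meshes of `d`-rectangles -/

/-- A nondegenerate `d`-rectangle `∏_i [lo_i, hi_i]`. -/
structure Rect (d : ℕ) where
  lo : Fin d → ℝ
  hi : Fin d → ℝ
  lt : ∀ i, lo i < hi i

/-- The open rectangle. -/
def Rect.inner (K : Rect d) : Set (Fin d → ℝ) := Set.pi Set.univ fun i => Set.Ioo (K.lo i) (K.hi i)

/-- The closed rectangle. -/
def Rect.closed (K : Rect d) : Set (Fin d → ℝ) := Set.Icc K.lo K.hi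

/-- The Euclidean diameter. -/
def Rect.diam (K : Rect d) : ℝ := Real.sqrt (∑ i, (K.hi i - K.lo i) ^ 2)

/-- A decomposition of `Ω` into finitely many `d`-rectangles with disjoint interiors. -/
structure RectMesh (Ω : Set (Fin d → ℝ)) where
  elems : Finset (Rect d)
  inner_subset : ∀ K ∈ elems, K.inner ⊆ Ω
  cover : Ω ⊆ ⋃ K ∈ elems, K.closed
  disjoint : ∀ K ∈ elems, ∀ L ∈ elems, K ≠ L → Disjoint K.inner L.inner

/-- The mesh size `H`, the largest diameter of an element. -/
def RectMesh.size (𝒯 : RectMesh Ω) : ℝ := ⨆ K : 𝒯.elems, K.1.diam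

/-- Multi-indices of order at most `k`. -/
abbrev MultiIdx (d k : ℕ) : Type := {α : Fin d → Fin (k + 1) // ∑ i, (α i : ℕ) ≤ k}

/-- The multi-index `0`. -/
def MultiIdx.zero (d k : ℕ) : MultiIdx d k := ⟨fun _ => 0, by simp⟩

theorem integrable_mul_testFun {U : Set (Fin d → ℝ)} (hU : U ⊆ Ω) (g : L2 Ω)
    {φ : (Fin d → ℝ) → ℝ} (hc : Continuous φ) (hs : HasCompactSupport φ) :
    Integrable (fun x => g x * φ x) (volume.restrict U) := by
  have h1 : MemLp g 2 (volume.restrict U) :=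
    (Lp.memLp g).mono_measure (Measure.restrict_mono hU le_rfl)
  have h2 : MemLp φ 2 (volume.restrict U) :=
    (hc.memLp_of_hasCompactSupport hs).mono_measure Measure.restrict_le_self
  exact h1.integrable_mul h2

theorem integrable_mul_pderiv {U : Set (Fin d → ℝ)} (hU : U ⊆ Ω) (g : L2 Ω)
    {φ : (Fin d → ℝ) → ℝ} (hφ : IsTestFun U φ) (i : Fin d) :
    Integrable (fun x => g x * pderiv i φ x) (volume.restrict U) := by
  refine integrable_mul_testFun hU g ?_ ?_
  · exact (hφ.smooth.continuous_fderiv (by simp)).clm_apply continuous_const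
  · exact hφ.compact.fderiv_apply ℝ _

theorem ae_restrict_subset {U : Set (Fin d → ℝ)} (hU : U ⊆ Ω) {p : (Fin d → ℝ) → Prop}
    (h : ∀ᵐ x ∂(volume.restrict Ω), p x) : ∀ᵐ x ∂(volume.restrict U), p x :=
  ae_mono (Measure.restrict_mono hU le_rfl) h

/-- The broken Sobolev space `H^k(𝒯)`. A function `v` is represented by the family
`(∂^α v)_{|α| ≤ k}` of its elementwise weak derivatives, which lie in `L²(Ω)`; the function itself
is the entry at the multi-index `0`. The norm is
`(∑_{|α| ≤ k} ‖∂^α v‖²)^{1/2} = (∑_K ‖v‖²_{H^k(K)})^{1/2}`. -/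
def brokenSobolev (𝒯 : RectMesh Ω) (k : ℕ) : Submodule ℝ (PiLp 2 (fun _ : MultiIdx d k => L2 Ω)) where
  carrier := {g | ∀ K ∈ 𝒯.elems, ∀ (i : Fin d) (α β : MultiIdx d k),
    (∀ j, (β.1 j : ℕ) = α.1 j + if j = i then 1 else 0) → IsWeakPDeriv K.inner i (g α) (g β)}
  zero_mem' := by
    intro K hK i α β _ φ hφ
    have h : (⇑(0 : L2 Ω)) =ᵐ[volume.restrict K.inner] 0 :=
      ae_restrict_subset (𝒯.inner_subset K hK) (Lp.coeFn_zero ℝ 2 _)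
    have e1 : ∫ x in K.inner, (0 : L2 Ω) x * pderiv i φ x = 0 := by
      rw [integral_congr_ae (g := fun _ => 0)]
      · simp
      · filter_upwards [h] with x hx; rw [hx, Pi.zero_apply, zero_mul]
    have e2 : ∫ x in K.inner, (0 : L2 Ω) x * φ x = 0 := by
      rw [integral_congr_ae (g := fun _ => 0)]
      · simp
      · filter_upwards [h] with x hx; rw [hx, Pi.zero_apply, zero_mul]
    simp only [PiLp.zero_apply]
    rw [e1, e2, neg_zero]
  add_mem' := by
    intro g h hg hh K hK i α β hαβ φ hφ
    have hs := 𝒯.inner_subset K hK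
    have e1 : ∫ x in K.inner, (g α + h α) x * pderiv i φ x
        = (∫ x in K.inner, g α x * pderiv i φ x) + (∫ x in K.inner, h α x * pderiv i φ x) := by
      rw [← integral_add (integrable_mul_pderiv hs _ hφ i) (integrable_mul_pderiv hs _ hφ i)]
      refine integral_congr_ae ?_
      filter_upwards [ae_restrict_subset hs (Lp.coeFn_add (g α) (h α))] with x hx
      rw [hx, Pi.add_apply, add_mul]
    have e2 : ∫ x in K.inner, (g β + h β) x * φ x
        = (∫ x in K.inner, g β x * φ x) + (∫ x in K.inner, h β x * φ x) := by
      rw [← integral_add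
        (integrable_mul_testFun hs _ hφ.smooth.continuous hφ.compact)
        (integrable_mul_testFun hs _ hφ.smooth.continuous hφ.compact)]
      refine integral_congr_ae ?_
      filter_upwards [ae_restrict_subset hs (Lp.coeFn_add (g β) (h β))] with x hx
      rw [hx, Pi.add_apply, add_mul]
    simp only [PiLp.add_apply]
    rw [e1, e2, hg K hK i α β hαβ φ hφ, hh K hK i α β hαβ φ hφ, neg_add]
  smul_mem' := by
    intro c g hg K hK i α β hαβ φ hφ
    have hs := 𝒯.inner_subset K hK
    have e1 : ∫ x in K.inner, (c • g α) x * pderiv i φ x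
        = c * ∫ x in K.inner, g α x * pderiv i φ x := by
      rw [← integral_const_mul]
      refine integral_congr_ae ?_
      filter_upwards [ae_restrict_subset hs (Lp.coeFn_smul c (g α))] with x hx
      rw [hx, Pi.smul_apply, smul_eq_mul, mul_assoc]
    have e2 : ∫ x in K.inner, (c • g β) x * φ x = c * ∫ x in K.inner, g β x * φ x := by
      rw [← integral_const_mul]
      refine integral_congr_ae ?_
      filter_upwards [ae_restrict_subset hs (Lp.coeFn_smul c (g β))] with x hx
      rw [hx, Pi.smul_apply, smul_eq_mul, mul_assoc]
    simp only [PiLp.smul_apply]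
    rw [e1, e2, hg K hK i α β hαβ φ hφ, mul_neg]

/-- The function in `L²(Ω)` that underlies an element of `H^k(𝒯)`. -/
def brokenToL2 {𝒯 : RectMesh Ω} {k : ℕ} (g : brokenSobolev 𝒯 k) : L2 Ω :=
  (g : PiLp 2 (fun _ : MultiIdx d k => L2 Ω)) (MultiIdx.zero d k)

/-! ### The model problem -/

/-- A measurable coefficient with `a₀ ≤ A(x) ≤ b₀` for almost every `x ∈ Ω`. -/
structure IsCoefficient (Ω : Set (Fin d → ℝ)) (a₀ b₀ : ℝ) (A : (Fin d → ℝ) → ℝ) : Prop where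
  measurable : AEStronglyMeasurable A (volume.restrict Ω)
  bounds : ∀ᵐ x ∂(volume.restrict Ω), a₀ ≤ A x ∧ A x ≤ b₀

/-- `(A ∇u, ∇v)_{L²(S)}`. -/
def formOn (A : (Fin d → ℝ) → ℝ) (S : Set (Fin d → ℝ)) (u v : H10 Ω) : ℝ :=
  ∑ i, ∫ x in S, A x * grad i u x * grad i v x

/-- The bilinear form `a(u, v) = (A ∇u, ∇v)_{L²(Ω)}`. -/
def form (A : (Fin d → ℝ) → ℝ) (u v : H10 Ω) : ℝ := formOn A Ω u v

/-- The time derivative `∂_t u(t) ∈ H⁻¹(Ω)` on `[0, T]`, one-sided at the end points. -/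
def timeDeriv (T : ℝ) (u : ℝ → H10 Ω) (t : ℝ) : HMinusOne Ω :=
  derivWithin (fun s => toDual (toL2 (u s))) (Set.Icc 0 T) t

/-- `u` solves `⟨∂_t u, v⟩ + a(u, v) = (f, v)` for all `v ∈ H¹₀(Ω)` and all `t ∈ [0, T]`, with
`u(0) = u₀`. -/
structure IsWeakSolution (A : (Fin d → ℝ) → ℝ) (T : ℝ) (u₀ : H10 Ω) (f : ℝ → L2 Ω)
    (u : ℝ → H10 Ω) : Prop where
  init : u 0 = u₀
  diff : DifferentiableOn ℝ (fun s => toDual (toL2 (u s))) (Set.Icc 0 T)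
  eqn : ∀ t ∈ Set.Icc 0 T, ∀ v : H10 Ω, timeDeriv T u t v + form A (u t) v = toDual (f t) v

/-! ### The multiscale space -/

/-- The space `V_H` of functions that on each element are a polynomial of partial degree at
most `p`. -/
def polySpace (𝒯 : RectMesh Ω) (p : ℕ) : Submodule ℝ (L2 Ω) where
  carrier := {v | ∀ K ∈ 𝒯.elems, ∃ q : MvPolynomial (Fin d) ℝ, (∀ i, q.degreeOf i ≤ p) ∧
    v =ᵐ[volume.restrict K.inner] fun x => MvPolynomial.eval x q}
  zero_mem' := by
    intro K hK
    refine ⟨0, by simp, ?_⟩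
    filter_upwards [ae_restrict_subset (𝒯.inner_subset K hK) (Lp.coeFn_zero ℝ 2 _)] with x hx
    simpa using hx
  add_mem' := by
    intro v w hv hw K hK
    obtain ⟨q, hq, hvq⟩ := hv K hK
    obtain ⟨r, hr, hwr⟩ := hw K hK
    refine ⟨q + r, fun i => (MvPolynomial.degreeOf_add_le i q r).trans (max_le (hq i) (hr i)), ?_⟩
    filter_upwards [ae_restrict_subset (𝒯.inner_subset K hK) (Lp.coeFn_add v w), hvq, hwr]
      with x hx h1 h2
    rw [hx, Pi.add_apply, h1, h2, map_add]
  smul_mem' := by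
    intro c v hv K hK
    obtain ⟨q, hq, hvq⟩ := hv K hK
    refine ⟨MvPolynomial.C c * q,
      fun i => (MvPolynomial.degreeOf_C_mul_le q i c).trans (hq i), ?_⟩
    filter_upwards [ae_restrict_subset (𝒯.inner_subset K hK) (Lp.coeFn_smul c v), hvq] with x hx h1
    rw [hx, Pi.smul_apply, h1, smul_eq_mul, map_mul, MvPolynomial.eval_C]

theorem ae_of_forall_inner (𝒯 : RectMesh Ω) {P : (Fin d → ℝ) → Prop}
    (h : ∀ K ∈ 𝒯.elems, ∀ᵐ x ∂(volume.restrict K.inner), P x) :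
    ∀ᵐ x ∂(volume.restrict Ω), P x := by
  have hK : ∀ K ∈ 𝒯.elems, ∀ᵐ x ∂(volume.restrict K.closed), P x := by
    intro K hK
    have e : K.inner =ᵐ[volume] K.closed :=
      Measure.univ_pi_Ioo_ae_eq_Icc (μ := fun _ : Fin d => (volume : Measure ℝ))
        (f := K.lo) (g := K.hi)
    rw [← Measure.restrict_congr_set e]
    exact h K hK
  have hU : ∀ᵐ x ∂(volume.restrict (⋃ K ∈ 𝒯.elems, K.closed)), P x := by
    rw [ae_restrict_biUnion_finset_iff]
    exact hK
  exact ae_mono (Measure.restrict_mono 𝒯.cover le_rfl) hU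

/-- Restriction of `L²(Ω)` to an open element, as classes of measurable functions. -/
def restrictInner (𝒯 : RectMesh Ω) (K : 𝒯.elems) :
    L2 Ω →ₗ[ℝ] ((Fin d → ℝ) →ₘ[volume.restrict K.1.inner] ℝ) where
  toFun v := AEEqFun.mk v ((Lp.aestronglyMeasurable v).mono_measure
    (Measure.restrict_mono (𝒯.inner_subset K.1 K.2) le_rfl))
  map_add' v w := by
    rw [AEEqFun.mk_add_mk, AEEqFun.mk_eq_mk]
    exact ae_restrict_subset (𝒯.inner_subset K.1 K.2) (Lp.coeFn_add v w)
  map_smul' c v := by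
    rw [RingHom.id_apply, AEEqFun.smul_mk, AEEqFun.mk_eq_mk]
    exact ae_restrict_subset (𝒯.inner_subset K.1 K.2) (Lp.coeFn_smul c v)

/-- Polynomials as classes of measurable functions. -/
def polyClass (d : ℕ) (μ : Measure (Fin d → ℝ)) :
    MvPolynomial (Fin d) ℝ →ₗ[ℝ] ((Fin d → ℝ) →ₘ[μ] ℝ) where
  toFun q := AEEqFun.mk (fun x => MvPolynomial.eval x q)
    (MvPolynomial.continuous_eval q).aestronglyMeasurable
  map_add' q r := by
    rw [AEEqFun.mk_add_mk, AEEqFun.mk_eq_mk]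
    exact Filter.Eventually.of_forall fun x => by simp
  map_smul' c q := by
    rw [RingHom.id_apply, AEEqFun.smul_mk, AEEqFun.mk_eq_mk]
    exact Filter.Eventually.of_forall fun x => by simp

instance restrictDegree_finite (d p : ℕ) :
    Module.Finite ℝ (MvPolynomial.restrictDegree (Fin d) ℝ p) := by
  have hs : {n : Fin d →₀ ℕ | ∀ i, n i ≤ p}.Finite := by
    refine (Set.finite_Iic (Finsupp.equivFunOnFinite.symm fun _ : Fin d => p)).subset ?_
    intro n hn i
    exact hn i
  have : Finite {n : Fin d →₀ ℕ | ∀ i, n i ≤ p} := hs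
  exact Module.Finite.of_basis
    (MvPolynomial.basisRestrictSupport ℝ {n : Fin d →₀ ℕ | ∀ i, n i ≤ p})

instance polySpace_finiteDimensional (𝒯 : RectMesh Ω) (p : ℕ) :
    FiniteDimensional ℝ (polySpace 𝒯 p) := by
  let S : ∀ K : 𝒯.elems, Submodule ℝ ((Fin d → ℝ) →ₘ[volume.restrict K.1.inner] ℝ) := fun K =>
    (MvPolynomial.restrictDegree (Fin d) ℝ p).map (polyClass d (volume.restrict K.1.inner))
  have hfin : ∀ K, Module.Finite ℝ (S K) := fun K => inferInstance
  have hmem : ∀ (K : 𝒯.elems) (v : polySpace 𝒯 p), restrictInner 𝒯 K (v : L2 Ω) ∈ S K := by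
    intro K v
    obtain ⟨q, hq, hvq⟩ := v.2 K.1 K.2
    refine ⟨q, ?_, ?_⟩
    · rw [SetLike.mem_coe, MvPolynomial.mem_restrictDegree]
      intro s hs i
      exact (MvPolynomial.le_degreeOf_of_mem_support i hs).trans (hq i)
    · exact AEEqFun.mk_eq_mk.2 hvq.symm
  let Φ : polySpace 𝒯 p →ₗ[ℝ] (∀ K, S K) := LinearMap.pi fun K =>
    LinearMap.codRestrict (S K) ((restrictInner 𝒯 K).comp (polySpace 𝒯 p).subtype) (hmem K)
  refine Module.Finite.of_injective Φ ?_
  intro v w hvw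
  apply Subtype.ext
  apply Lp.ext
  refine ae_of_forall_inner 𝒯 fun K hK => ?_
  have h := congrArg Subtype.val (congrFun hvw ⟨K, hK⟩)
  exact AEEqFun.mk_eq_mk.1 h

/-- The `L²`-projection `Π` onto `V_H`. -/
def polyProj (𝒯 : RectMesh Ω) (p : ℕ) (v : L2 Ω) : polySpace 𝒯 p :=
  (polySpace 𝒯 p).orthogonalProjectionOnto v

/-- The space `W`, the kernel of `Π` in `H¹₀(Ω)`. -/
def fineSpace (𝒯 : RectMesh Ω) (p : ℕ) : Set (H10 Ω) := {w | polyProj 𝒯 p (toL2 w) = 0}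

/-- The continuous functions with zero trace that are piecewise affine in each variable. -/
def affineZero (𝒯 : RectMesh Ω) : Submodule ℝ (H10 Ω) where
  carrier := {w | toL2 w ∈ polySpace 𝒯 1 ∧ ∃ g : (Fin d → ℝ) → ℝ,
    ContinuousOn g (closure Ω) ∧ toL2 w =ᵐ[volume.restrict Ω] g}
  zero_mem' := by
    refine ⟨by simp, fun _ => 0, continuousOn_const, ?_⟩
    rw [map_zero]; exact Lp.coeFn_zero ℝ 2 _
  add_mem' := by
    rintro v w ⟨hv, g, hg, hvg⟩ ⟨hw, h, hh, hwh⟩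
    refine ⟨by rw [map_add]; exact add_mem hv hw, fun x => g x + h x, hg.add hh, ?_⟩
    rw [map_add]
    filter_upwards [Lp.coeFn_add (toL2 v) (toL2 w), hvg, hwh] with x hx h1 h2
    rw [hx, Pi.add_apply, h1, h2]
  smul_mem' := by
    rintro c v ⟨hv, g, hg, hvg⟩
    refine ⟨by rw [map_smul]; exact Submodule.smul_mem _ c hv, fun x => c * g x,
      continuousOn_const.mul hg, ?_⟩
    rw [map_smul]
    filter_upwards [Lp.coeFn_smul c (toL2 v), hvg] with x hx h1
    rw [hx, Pi.smul_apply, h1, smul_eq_mul]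

/-- `B` is a bubble operator: it maps every `v ∈ V_H` that vanishes outside an element `K` to a
function in `H¹₀(K)` with the same `L²`-projection. (To give such a linear map is to
choose one bubble function in `H¹₀(K)` for each member of a basis, such as that of the Legendre
polynomials, of the polynomials on each element `K`.) -/
def IsBubbleOperator (𝒯 : RectMesh Ω) (p : ℕ) (B : polySpace 𝒯 p →ₗ[ℝ] H10 Ω) : Prop :=
  ∀ K ∈ 𝒯.elems, ∀ v : polySpace 𝒯 p,
    (∀ L ∈ 𝒯.elems, L ≠ K → (v : L2 Ω) =ᵐ[volume.restrict L.inner] 0) →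
    (B v : GradPair Ω) ∈ sobolevZero Ω K.inner ∧
      ∀ q ∈ polySpace 𝒯 p, inner ℝ (toL2 (B v)) q = inner ℝ (v : L2 Ω) q

/-- The quasi-interpolation `I = E ∘ π`: the `L²`-projection `π` onto piecewise constants, followed
by a linear map `E` from piecewise constant functions to continuous piecewise affine functions with
zero trace. The usual choice of `E` averages the values of the adjacent elements at each interior
vertex. -/
def quasiInterp (𝒯 : RectMesh Ω) (E : polySpace 𝒯 0 →ₗ[ℝ] affineZero 𝒯) (v : L2 Ω) : H10 Ω :=
  E (polyProj 𝒯 0 v)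

/-- The operator `v ↦ I v + B Π (v - I v)`. -/
def stabInterp (𝒯 : RectMesh Ω) (p : ℕ) (E : polySpace 𝒯 0 →ₗ[ℝ] affineZero 𝒯)
    (B : polySpace 𝒯 p →ₗ[ℝ] H10 Ω) (v : L2 Ω) : H10 Ω :=
  quasiInterp 𝒯 E v + B (polyProj 𝒯 p (v - toL2 (quasiInterp 𝒯 E v)))

/-- The stabilized bubble space `U_H`, the image of `V_H` under `stabInterp`. -/
def bubbleSpace (𝒯 : RectMesh Ω) (p : ℕ) (E : polySpace 𝒯 0 →ₗ[ℝ] affineZero 𝒯)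
    (B : polySpace 𝒯 p →ₗ[ℝ] H10 Ω) : Set (H10 Ω) :=
  {z | ∃ v ∈ polySpace 𝒯 p, z = stabInterp 𝒯 p E B v}

/-- `c = C_K v` for the global element correction `C_K : H¹₀(Ω) → W` of the element `K`:
`a(C_K v, w) = (A ∇v, ∇w)_{L²(K)}` for all `w ∈ W`. -/
def IsElementCorrection (𝒯 : RectMesh Ω) (p : ℕ) (A : (Fin d → ℝ) → ℝ) (K : Rect d)
    (v c : H10 Ω) : Prop :=
  c ∈ fineSpace 𝒯 p ∧ ∀ w ∈ fineSpace 𝒯 p, form A c w = formOn A K.inner v w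

/-- `c = C v` for the global correction `C = ∑_K C_K`. -/
def IsCorrection (𝒯 : RectMesh Ω) (p : ℕ) (A : (Fin d → ℝ) → ℝ) (v c : H10 Ω) : Prop :=
  ∃ cK : Rect d → H10 Ω, (∀ K ∈ 𝒯.elems, IsElementCorrection 𝒯 p A K v (cK K)) ∧
    c = ∑ K ∈ 𝒯.elems, cK K

/-- The multiscale space `(1 - C) U_H`. -/
def multiscaleSpace (𝒯 : RectMesh Ω) (p : ℕ) (A : (Fin d → ℝ) → ℝ)
    (E : polySpace 𝒯 0 →ₗ[ℝ] affineZero 𝒯) (B : polySpace 𝒯 p →ₗ[ℝ] H10 Ω) : Set (H10 Ω) :=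
  {z | ∃ v ∈ bubbleSpace 𝒯 p E B, ∃ c, IsCorrection 𝒯 p A v c ∧ z = v - c}

/-- `q` is the projection of `v` into the multiscale space `V`, orthogonal with respect to `a`. -/
def IsMultiscaleProj (A : (Fin d → ℝ) → ℝ) (V : Set (H10 Ω)) (v q : H10 Ω) : Prop :=
  q ∈ V ∧ ∀ z ∈ V, form A q z = form A v z

/-- `e = D F` for the enriched correction operator: `e ∈ W` and `a(e, w) = -⟨F, w⟩` for all `w ∈ W`.
For `F = toDual v` with `v ∈ L²(Ω)`, the right-hand side is `-(v, w)`. -/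
def IsEnrichedCorrection (𝒯 : RectMesh Ω) (p : ℕ) (A : (Fin d → ℝ) → ℝ) (F : HMinusOne Ω)
    (e : H10 Ω) : Prop :=
  e ∈ fineSpace 𝒯 p ∧ ∀ w ∈ fineSpace 𝒯 p, form A e w = -F w

end MultiscaleHeat

end

noncomputable section

namespace MultiscaleHeat

variable {d : ℕ}

/-! ### Calculus of polynomials on a rectangle -/

/-! The operator $\mathcal X$ preserves moments against $V_H$, and this forces $\widetilde
V_H=(1-\mathcal C)U_H$ to be the whole $a$-orthogonal complement of $W$ in $H^1_0(\Omega)$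
(`mem_multiscaleSpace_iff`). Hence $\widetilde P$ is the $a$-orthogonal projection along $W$, and
$u-\widetilde Pu\in W$. The error $z=u-\widetilde Pu-\mathcal D(\partial_tu)$ therefore lies in $W$,
and the equation gives $a(z,w)=a(u,w)+\langle\partial_tu,w\rangle=(f,w)$ for all $w\in W$, at each
fixed time. With $w=z$ and $z\perp V_H$ it follows that $\alpha\|\nabla
z\|^2\le(f-r,z)\le\|f-r\|\,\|z\|$ for every $r\in V_H$. The first factor is of order
$H^{p+1}\|f\|_{H^k(\mathcal T_H)}$ (`exists_mem_polySpace_norm_brokenToL2_sub_le`), the second of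
order $H\|\nabla z\|$ (`norm_toL2_le_of_orthogonal`).

Both factors come from one Bramble–Hilbert estimate on a rectangle of arbitrary aspect ratio,
`Rect.exists_polynomial_integral_sq_sub_le`, with a constant that depends on $d$ and $p$ only. Its
proof uses tensor Legendre polynomials, an orthogonal system that is complete in $L^2(K)$. If
$n_i\ge p+1$, Rodrigues' formula writes the polynomial of index $n$ as $\partial_i^{p+1}G$, where
$G,\dots,\partial_i^pG$ vanish on the two faces orthogonal to $e_i$. Integration by parts moves the
derivatives onto the function without boundary terms, and a Poincaré inequality for polynomials
bounds $\|G\|$ by $(2h_i)^{p+1}\|\partial_i^{p+1}G\|$. All other indices belong to polynomials of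
partial degree at most $p$, and these form the approximation. -/

theorem contDiff_eval (q : MvPolynomial (Fin d) ℝ) :
    ContDiff ℝ ∞ fun x : Fin d → ℝ => MvPolynomial.eval x q :=
  (AnalyticOnNhd.eval_mvPolynomial (𝕜 := ℝ) q).contDiff

theorem pderiv_eval (i : Fin d) (q : MvPolynomial (Fin d) ℝ) :
    pderiv i (fun x => MvPolynomial.eval x q) =
      fun x => MvPolynomial.eval x (MvPolynomial.pderiv i q) := by
  have hdiff : ∀ (q : MvPolynomial (Fin d) ℝ) (x : Fin d → ℝ),
      DifferentiableAt ℝ (fun x => MvPolynomial.eval x q) x := fun q x =>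
    ((contDiff_eval q).differentiable (by simp)) x
  funext x
  induction q using MvPolynomial.induction_on with
  | C a => simp [pderiv]
  | add q r hq hr =>
    simp only [pderiv, map_add] at *
    rw [fderiv_fun_add (hdiff q x) (hdiff r x), add_apply, hq, hr]
  | mul_X q j hq =>
    have hX : HasFDerivAt (fun y : Fin d → ℝ => y j) (ContinuousLinearMap.proj j) x :=
      (ContinuousLinearMap.proj (R := ℝ) (φ := fun _ : Fin d => ℝ) j).hasFDerivAt
    simp only [pderiv, map_mul, MvPolynomial.eval_X] at *
    rw [((hdiff q x).hasFDerivAt.fun_mul hX).fderiv]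
    simp only [add_apply, smul_apply, hq,
      ContinuousLinearMap.proj_apply, smul_eq_mul, Derivation.leibniz, map_add, map_mul,
      MvPolynomial.eval_X, MvPolynomial.pderiv_X, Pi.single_apply]
    by_cases h : j = i
    · simp [h]
    · simp [h]

theorem pderiv_eq_of_hasDerivAt {φ : (Fin d → ℝ) → ℝ} {x : Fin d → ℝ} {i : Fin d} {D : ℝ}
    (hφ : DifferentiableAt ℝ φ x)
    (h : HasDerivAt (fun t => φ (Function.update x i t)) D (x i)) : pderiv i φ x = D := by
  have h1 : HasFDerivAt φ (fderiv ℝ φ x) (Function.update x i (x i)) := by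
    rw [Function.update_eq_self]; exact hφ.hasFDerivAt
  exact (h1.comp_hasDerivAt (x i) (hasDerivAt_update x i (x i))).unique h

theorem Rect.isOpen_inner (K : Rect d) : IsOpen K.inner :=
  isOpen_set_pi finite_univ fun _ _ => isOpen_Ioo

theorem Rect.inner_subset_closed (K : Rect d) : K.inner ⊆ K.closed := fun _ hx =>
  ⟨fun i => (hx i trivial).1.le, fun i => (hx i trivial).2.le⟩

theorem Rect.isCompact_closed (K : Rect d) : IsCompact K.closed := isCompact_Icc

theorem Rect.volume_inner_lt_top (K : Rect d) : volume K.inner < ⊤ :=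
  (measure_mono K.inner_subset_closed).trans_lt K.isCompact_closed.measure_lt_top

instance Rect.isFiniteMeasure_inner (K : Rect d) : IsFiniteMeasure (volume.restrict K.inner) :=
  ⟨by rw [Measure.restrict_apply_univ]; exact K.volume_inner_lt_top⟩

theorem Rect.exists_bound (K : Rect d) {φ : (Fin d → ℝ) → ℝ} (hφ : Continuous φ) :
    ∃ M, 0 ≤ M ∧ ∀ x ∈ K.inner, |φ x| ≤ M := by
  obtain ⟨M, hM⟩ := K.isCompact_closed.exists_bound_of_continuousOn hφ.continuousOn
  exact ⟨max M 0, le_max_right _ _, fun x hx =>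
    (hM x (K.inner_subset_closed hx)).trans (le_max_left _ _)⟩

theorem Rect.memLp_of_continuous (K : Rect d) {φ : (Fin d → ℝ) → ℝ} (hφ : Continuous φ) :
    MemLp φ 2 (volume.restrict K.inner) := by
  obtain ⟨M, -, hM⟩ := K.exists_bound hφ
  exact MemLp.of_bound hφ.aestronglyMeasurable M
    ((ae_restrict_iff' K.isOpen_inner.measurableSet).2 (.of_forall hM))

/-- The polynomial `(x_i - a_i)(b_i - x_i)`, which vanishes on two opposite faces. -/
def Rect.edge (K : Rect d) (i : Fin d) : MvPolynomial (Fin d) ℝ :=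
  (MvPolynomial.X i - MvPolynomial.C (K.lo i)) * (MvPolynomial.C (K.hi i) - MvPolynomial.X i)

theorem Rect.eval_edge (K : Rect d) (i : Fin d) (x : Fin d → ℝ) :
    MvPolynomial.eval x (K.edge i) = (x i - K.lo i) * (K.hi i - x i) := by
  simp [Rect.edge]

theorem Rect.mem_inner_iff (K : Rect d) (x : Fin d → ℝ) :
    x ∈ K.inner ↔ ∀ i, 0 < MvPolynomial.eval x (K.edge i) := by
  simp only [Rect.inner, Set.mem_pi, Set.mem_univ, true_implies, Set.mem_Ioo, K.eval_edge]
  refine forall_congr' fun i => ⟨fun h => mul_pos (by linarith) (by linarith), fun h => ?_⟩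
  have := K.lt i
  constructor <;> nlinarith

/-! ### Cutoff functions -/

/-- A smooth step that vanishes below `1` and equals `1` above `2`. -/
def step (y : ℝ) : ℝ := Real.smoothTransition (y - 1)

theorem contDiff_step : ContDiff ℝ ∞ step :=
  Real.smoothTransition.contDiff.comp (contDiff_id.sub contDiff_const)

theorem step_eq_zero {y : ℝ} (h : y ≤ 1) : step y = 0 :=
  Real.smoothTransition.zero_of_nonpos (by linarith)

theorem step_eq_one {y : ℝ} (h : 2 ≤ y) : step y = 1 :=
  Real.smoothTransition.one_of_one_le (by linarith)

theorem abs_step_le (y : ℝ) : |step y| ≤ 1 := by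
  rw [step, abs_of_nonneg (Real.smoothTransition.nonneg _)]
  exact Real.smoothTransition.le_one _

theorem deriv_step_eq_zero {y : ℝ} (h : 2 < y) : deriv step y = 0 := by
  have : step =ᶠ[nhds y] fun _ => 1 := by
    filter_upwards [lt_mem_nhds h] with z hz using step_eq_one hz.le
  rw [this.deriv_eq, deriv_const]

/-- The derivative of a cutoff at scale $1/N$ has size $N$. Multiplied by a function that vanishes
on the face it becomes $y\,\mathrm{step}'(y)$ with $y=N\cdot$`edge`, which is bounded uniformly in
$N$. -/
theorem exists_bound_mul_deriv_step : ∃ M, 0 ≤ M ∧ ∀ y, 0 ≤ y → |y * deriv step y| ≤ M := by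
  have hc : Continuous fun y => y * deriv step y :=
    continuous_id.mul (contDiff_step.continuous_deriv (by simp))
  obtain ⟨M, hM⟩ := (isCompact_Icc (a := (0 : ℝ)) (b := 2)).exists_bound_of_continuousOn
    hc.continuousOn
  refine ⟨max M 0, le_max_right _ _, fun y hy => ?_⟩
  by_cases h : y ≤ 2
  · exact (hM y ⟨hy, h⟩).trans (le_max_left _ _)
  · rw [deriv_step_eq_zero (not_le.1 h), mul_zero, abs_zero]
    exact le_max_right _ _

/-- The product of the cutoffs in the directions `j ∈ s`. -/
def Rect.cutoff (K : Rect d) (s : Finset (Fin d)) (N : ℝ) (x : Fin d → ℝ) : ℝ :=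
  ∏ j ∈ s, step (N * MvPolynomial.eval x (K.edge j))

theorem Rect.contDiff_cutoff (K : Rect d) (s : Finset (Fin d)) (N : ℝ) :
    ContDiff ℝ ∞ (K.cutoff s N) :=
  contDiff_prod fun _ _ => contDiff_step.comp (contDiff_const.mul (contDiff_eval _))

theorem Rect.abs_cutoff_le (K : Rect d) (s : Finset (Fin d)) (N : ℝ) (x : Fin d → ℝ) :
    |K.cutoff s N x| ≤ 1 := by
  rw [Rect.cutoff, Finset.abs_prod]
  exact Finset.prod_le_one (fun _ _ => abs_nonneg _) fun _ _ => abs_step_le _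

/-- The support lies where every $N\cdot$`edge` is at least $1$, a closed set inside the open
rectangle. -/
theorem Rect.cutoff_mul_isTestFun (K : Rect d) {N : ℝ} (hN : 0 < N) {φ : (Fin d → ℝ) → ℝ}
    (hφ : ContDiff ℝ ∞ φ) :
    IsTestFun K.inner fun x => K.cutoff Finset.univ N x * φ x := by
  set S : Set (Fin d → ℝ) := {x | ∀ j, 1 ≤ N * MvPolynomial.eval x (K.edge j)} with hS
  have hclosed : IsClosed S := by
    rw [hS, ofPred_forall]
    exact isClosed_iInter fun j =>
      isClosed_le continuous_const (continuous_const.mul (MvPolynomial.continuous_eval _))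
  have hsub : S ⊆ K.inner := by
    intro x hx
    rw [K.mem_inner_iff]
    intro i
    exact pos_of_mul_pos_right (lt_of_lt_of_le one_pos (hx i)) hN.le
  have hsupp : tsupport (fun x => K.cutoff Finset.univ N x * φ x) ⊆ S := by
    refine closure_minimal (fun x hx j => ?_) hclosed
    by_contra h
    refine hx ?_
    have : K.cutoff Finset.univ N x = 0 :=
      Finset.prod_eq_zero (Finset.mem_univ j) (step_eq_zero (not_le.1 h).le)
    simp [this]
  refine ⟨(K.contDiff_cutoff _ _).mul hφ, ?_, hsupp.trans hsub⟩
  exact K.isCompact_closed.of_isClosed_subset (isClosed_tsupport _)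
    (hsupp.trans (hsub.trans K.inner_subset_closed))

theorem Rect.pderiv_cutoff_mul (K : Rect d) (i : Fin d) (N : ℝ) {φ : (Fin d → ℝ) → ℝ}
    (hφ : ContDiff ℝ ∞ φ) (x : Fin d → ℝ) :
    pderiv i (fun x => K.cutoff Finset.univ N x * φ x) x =
      deriv step (N * MvPolynomial.eval x (K.edge i)) * (N * (K.lo i + K.hi i - 2 * x i)) *
        K.cutoff (Finset.univ.erase i) N x * φ x + K.cutoff Finset.univ N x * pderiv i φ x := by
  have hd : ∀ {φ : (Fin d → ℝ) → ℝ}, ContDiff ℝ ∞ φ → DifferentiableAt ℝ φ x :=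
    fun h => (h.differentiable (by simp)) x
  have hc := K.contDiff_cutoff Finset.univ N
  have e : pderiv i (fun x => K.cutoff Finset.univ N x * φ x) x =
      K.cutoff Finset.univ N x * pderiv i φ x + φ x * pderiv i (K.cutoff Finset.univ N) x := by
    rw [pderiv, fderiv_fun_mul (hd hc) (hd hφ)]
    rfl
  have e2 : pderiv i (K.cutoff Finset.univ N) x =
      deriv step (N * MvPolynomial.eval x (K.edge i)) * (N * (K.lo i + K.hi i - 2 * x i)) *
        K.cutoff (Finset.univ.erase i) N x := by
    refine pderiv_eq_of_hasDerivAt (hd hc) ?_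
    have hfun : (fun t => K.cutoff Finset.univ N (Function.update x i t)) = fun t =>
        step (N * ((t - K.lo i) * (K.hi i - t))) * K.cutoff (Finset.univ.erase i) N x := by
      funext t
      rw [Rect.cutoff, ← Finset.mul_prod_erase _ _ (Finset.mem_univ i), Rect.cutoff]
      congr 1
      · rw [K.eval_edge, Function.update_self]
      · refine Finset.prod_congr rfl fun j hj => ?_
        rw [K.eval_edge, K.eval_edge, Function.update_of_ne (Finset.ne_of_mem_erase hj)]
    rw [hfun]
    have h1 : HasDerivAt (fun t => N * ((t - K.lo i) * (K.hi i - t)))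
        (N * (K.lo i + K.hi i - 2 * x i)) (x i) := by
      have := ((((hasDerivAt_id (x i)).sub_const (K.lo i)).fun_mul
        ((hasDerivAt_id (x i)).const_sub (K.hi i)))).const_mul N
      exact this.congr_deriv (by rw [id]; ring)
    have h2 : HasDerivAt step (deriv step (N * ((x i - K.lo i) * (K.hi i - x i))))
        (N * ((x i - K.lo i) * (K.hi i - x i))) :=
      ((contDiff_step.differentiable (by simp)) _).hasDerivAt
    rw [K.eval_edge]
    exact (HasDerivAt.comp (x i) h2 h1).mul_const _
  rw [e, e2]; ring

/-- Integration by parts of a weak derivative against a polynomial that vanishes on the two faces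
orthogonal to `e_i`. -/
theorem IsWeakPDeriv.integral_mul_pderiv_edge_mul {K : Rect d} {i : Fin d}
    {v w : (Fin d → ℝ) → ℝ} (h : IsWeakPDeriv K.inner i v w)
    (hv : Integrable v (volume.restrict K.inner)) (hw : Integrable w (volume.restrict K.inner))
    (G : MvPolynomial (Fin d) ℝ) :
    ∫ x in K.inner, v x * MvPolynomial.eval x (MvPolynomial.pderiv i (K.edge i * G)) =
      -∫ x in K.inner, w x * MvPolynomial.eval x (K.edge i * G) := by
  set φ : (Fin d → ℝ) → ℝ := fun x => MvPolynomial.eval x (K.edge i * G) with hφ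
  have hφs : ContDiff ℝ ∞ φ := contDiff_eval _
  have hφd : ∀ x, MvPolynomial.eval x (MvPolynomial.pderiv i (K.edge i * G)) = pderiv i φ x :=
    fun x => by rw [hφ, pderiv_eval]
  have hφdc : Continuous (pderiv i φ) := by
    rw [hφ, pderiv_eval]; exact MvPolynomial.continuous_eval _
  simp only [hφd]
  set c : ℕ → (Fin d → ℝ) → ℝ := fun N x => K.cutoff Finset.univ (N + 1 : ℝ) x with hc
  have hmeas : MeasurableSet K.inner := K.isOpen_inner.measurableSet
  have key : ∀ N : ℕ, ∫ x in K.inner, v x * pderiv i (fun x => c N x * φ x) x =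
      -∫ x in K.inner, w x * (c N x * φ x) := fun N =>
    h _ (K.cutoff_mul_isTestFun (by positivity) hφs)
  obtain ⟨M₁, hM₁, hb₁⟩ := exists_bound_mul_deriv_step
  obtain ⟨M₂, hM₂, hb₂⟩ := K.exists_bound
    (φ := fun x => (K.lo i + K.hi i - 2 * x i) * MvPolynomial.eval x G)
    (Continuous.mul (by fun_prop) (MvPolynomial.continuous_eval G))
  obtain ⟨M₃, hM₃, hb₃⟩ := K.exists_bound hφdc
  obtain ⟨M₄, hM₄, hb₄⟩ := K.exists_bound hφs.continuous
  -- The factor `K.edge i` of `φ` is placed beside $N\,\mathrm{step}'$. The first summand is then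
  -- bounded by `M₁ * M₂` for all $N$ and is eventually zero at each interior point, so dominated
  -- convergence applies.
  have hsplit : ∀ (N : ℕ) x, pderiv i (fun x => c N x * φ x) x =
      ((N + 1 : ℝ) * MvPolynomial.eval x (K.edge i)) *
          deriv step ((N + 1 : ℝ) * MvPolynomial.eval x (K.edge i)) *
        ((K.lo i + K.hi i - 2 * x i) * MvPolynomial.eval x G) *
          K.cutoff (Finset.univ.erase i) (N + 1 : ℝ) x + c N x * pderiv i φ x := by
    intro N x
    rw [hc, K.pderiv_cutoff_mul i _ hφs, hφ]
    simp only [map_mul]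
    ring
  have hev : ∀ x ∈ K.inner, ∀ j, ∀ᶠ N : ℕ in Filter.atTop,
      2 < (N + 1 : ℝ) * MvPolynomial.eval x (K.edge j) := by
    intro x hx j
    have h0 := (K.mem_inner_iff x).1 hx j
    have : Filter.Tendsto (fun N : ℕ => (N + 1 : ℝ) * MvPolynomial.eval x (K.edge j))
        Filter.atTop Filter.atTop :=
      (Filter.tendsto_atTop_add_const_right _ _ tendsto_natCast_atTop_atTop).atTop_mul_const h0
    exact this.eventually_gt_atTop 2
  have hcev : ∀ x ∈ K.inner, ∀ᶠ N : ℕ in Filter.atTop, c N x = 1 := by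
    intro x hx
    have := Filter.eventually_all.2 (hev x hx)
    filter_upwards [this] with N hN
    exact Finset.prod_eq_one fun j _ => step_eq_one (hN j).le
  have lim1 : Filter.Tendsto (fun N : ℕ => ∫ x in K.inner, v x * pderiv i (fun x => c N x * φ x) x)
      Filter.atTop (nhds (∫ x in K.inner, v x * pderiv i φ x)) := by
    refine tendsto_integral_of_dominated_convergence (fun x => |v x| * (M₁ * M₂ + M₃)) ?_ ?_ ?_ ?_
    · intro N
      refine hv.aestronglyMeasurable.mul (Continuous.aestronglyMeasurable ?_)
      exact ((((K.contDiff_cutoff _ _).mul hφs).continuous_fderiv (by simp)).clm_apply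
        continuous_const)
    · exact hv.abs.mul_const _
    · intro N
      refine (ae_restrict_iff' hmeas).2 (.of_forall fun x hx => ?_)
      rw [Real.norm_eq_abs, abs_mul, hsplit]
      gcongr
      refine (abs_add_le _ _).trans (add_le_add ?_ ?_)
      · rw [abs_mul, abs_mul]
        have h0 := ((K.mem_inner_iff x).1 hx i).le
        calc _ ≤ M₁ * M₂ * 1 := by
              gcongr
              · exact hb₁ _ (by positivity)
              · exact hb₂ x hx
              · exact K.abs_cutoff_le _ _ _
          _ = _ := mul_one _
      · rw [abs_mul]
        calc _ ≤ 1 * M₃ := by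
              gcongr
              · exact K.abs_cutoff_le _ _ _
              · exact hb₃ x hx
          _ = _ := one_mul _
    · refine (ae_restrict_iff' hmeas).2 (.of_forall fun x hx => ?_)
      refine Filter.Tendsto.congr' ?_ tendsto_const_nhds
      filter_upwards [hev x hx i, hcev x hx] with N h1 h2
      rw [hsplit, deriv_step_eq_zero h1, h2]
      ring
  have lim2 : Filter.Tendsto (fun N : ℕ => ∫ x in K.inner, w x * (c N x * φ x))
      Filter.atTop (nhds (∫ x in K.inner, w x * φ x)) := by
    refine tendsto_integral_of_dominated_convergence (fun x => |w x| * M₄) ?_ ?_ ?_ ?_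
    · intro N
      exact hw.aestronglyMeasurable.mul
        ((K.contDiff_cutoff _ _).mul hφs).continuous.aestronglyMeasurable
    · exact hw.abs.mul_const _
    · intro N
      refine (ae_restrict_iff' hmeas).2 (.of_forall fun x hx => ?_)
      rw [Real.norm_eq_abs, abs_mul, abs_mul]
      gcongr
      calc _ ≤ 1 * M₄ := by
              gcongr
              · exact K.abs_cutoff_le _ _ _
              · exact hb₄ x hx
          _ = _ := one_mul _
    · refine (ae_restrict_iff' hmeas).2 (.of_forall fun x hx => ?_)
      refine Filter.Tendsto.congr' ?_ tendsto_const_nhds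
      filter_upwards [hcev x hx] with N h2
      rw [h2, one_mul]
  refine tendsto_nhds_unique lim1 ?_
  simp only [key]
  exact lim2.neg

theorem isWeakPDeriv_of_contDiff {U : Set (Fin d → ℝ)} (i : Fin d)
    {g : (Fin d → ℝ) → ℝ} (hg : ContDiff ℝ ∞ g) : IsWeakPDeriv U i g (pderiv i g) := by
  intro φ hφ
  have hpc : ∀ {g : (Fin d → ℝ) → ℝ}, ContDiff ℝ ∞ g → Continuous (pderiv i g) :=
    fun h => (h.continuous_fderiv (by simp)).clm_apply continuous_const
  have hz : ∀ x, x ∉ U → φ x = 0 := fun x hx =>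
    image_eq_zero_of_notMem_tsupport fun h => hx (hφ.supp h)
  have hz' : ∀ x, x ∉ U → pderiv i φ x = 0 := by
    intro x hx
    have : fderiv ℝ φ x = 0 := image_eq_zero_of_notMem_tsupport
      fun h => hx (hφ.supp (tsupport_fderiv_subset ℝ h))
    rw [pderiv, this]; rfl
  rw [setIntegral_eq_integral_of_forall_compl_eq_zero (fun x hx => by rw [hz' x hx, mul_zero]),
    setIntegral_eq_integral_of_forall_compl_eq_zero (fun x hx => by rw [hz x hx, mul_zero])]
  refine integral_mul_fderiv_eq_neg_fderiv_mul_of_integrable ?_ ?_ ?_ ?_ ?_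
  · exact ((hpc hg).mul hφ.smooth.continuous).integrable_of_hasCompactSupport
      hφ.compact.mul_left
  · exact (hg.continuous.mul (hpc hφ.smooth)).integrable_of_hasCompactSupport
      (hφ.compact.fderiv_apply ℝ _).mul_left
  · exact (hg.continuous.mul hφ.smooth.continuous).integrable_of_hasCompactSupport
      hφ.compact.mul_left
  · exact fun x _ => (hg.differentiable (by simp)) x
  · exact fun x _ => (hφ.smooth.differentiable (by simp)) x

/-! ### Approximation in a Hilbert space with an orthogonal system -/

/-- The map `c` sorts the orthogonal system into mutually orthogonal classes, and `q` is the
projection of `v` onto the class `none`. Against a finite combination $s$, the residual $v-q$ sees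
only the components of $s$ in the classes `some i`; there it acts like $v$, and each component has
norm at most $\|s\|$. Density extends the bound to $s=v-q$, without any infinite expansion. -/
theorem exists_mem_span_norm_sub_le {X ι κ : Type*} [NormedAddCommGroup X]
    [InnerProductSpace ℝ X] [Fintype κ] (e : ι → X)
    (he : ∀ m n, m ≠ n → inner ℝ (e m) (e n) = 0)
    (hdense : (Submodule.span ℝ (range e)).topologicalClosure = ⊤)
    (c : ι → Option κ) (hfin : {n | c n = none}.Finite) (v : X) (M : κ → ℝ)
    (hv : ∀ i, ∀ s ∈ Submodule.span ℝ (e '' {n | c n = some i}), |inner ℝ v s| ≤ M i * ‖s‖)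
    (hM : ∀ i, 0 ≤ M i) :
    ∃ q ∈ Submodule.span ℝ (e '' {n | c n = none}), ‖v - q‖ ≤ ∑ i, M i := by
  classical
  set S : Option κ → Submodule ℝ X := fun o => Submodule.span ℝ (e '' {n | c n = o}) with hS
  have : FiniteDimensional ℝ (S none) := FiniteDimensional.span_of_finite ℝ (hfin.image e)
  have hortho : ∀ o o', o ≠ o' → S o ⟂ S o' := by
    intro o o' hne
    rw [hS, Submodule.isOrtho_span]
    rintro _ ⟨m, hm, rfl⟩ _ ⟨n, hn, rfl⟩
    refine he m n fun h => hne ?_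
    rw [← show c m = o from hm, ← show c n = o' from hn, h]
  have hdec : ∀ s ∈ Submodule.span ℝ (range e), ∃ t : Option κ → X,
      (∀ o, t o ∈ S o) ∧ s = ∑ o, t o := by
    intro s hs
    induction hs using Submodule.span_induction with
    | mem x hx =>
      obtain ⟨n, rfl⟩ := hx
      refine ⟨fun o => if o = c n then e n else 0, fun o => ?_, by simp⟩
      dsimp only
      split_ifs with h
      · exact Submodule.subset_span ⟨n, h.symm, rfl⟩
      · exact zero_mem _
    | zero => exact ⟨fun _ => 0, fun _ => zero_mem _, by simp⟩
    | add x y _ _ hx hy =>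
      obtain ⟨t, ht, rfl⟩ := hx
      obtain ⟨t', ht', rfl⟩ := hy
      exact ⟨fun o => t o + t' o, fun o => add_mem (ht o) (ht' o), by
        rw [Finset.sum_add_distrib]⟩
    | smul a x _ hx =>
      obtain ⟨t, ht, rfl⟩ := hx
      exact ⟨fun o => a • t o, fun o => Submodule.smul_mem _ a (ht o), by
        rw [Finset.smul_sum]⟩
  set q : X := (S none).starProjection v with hq
  have hqm : q ∈ S none := Submodule.starProjection_apply_mem _ _
  have hr : ∀ s ∈ S none, inner ℝ (v - q) s = 0 := fun s hs =>
    (S none).starProjection_inner_eq_zero v s hs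
  refine ⟨q, hqm, ?_⟩
  have hbound : ∀ s ∈ Submodule.span ℝ (range e), |inner ℝ (v - q) s| ≤ (∑ i, M i) * ‖s‖ := by
    intro s hs
    obtain ⟨t, ht, hst⟩ := hdec s hs
    have hle : ∀ o, ‖t o‖ ≤ ‖s‖ := by
      intro o
      have h1 : inner ℝ (t o) s = ‖t o‖ ^ 2 := by
        rw [hst, inner_sum, Finset.sum_eq_single o, real_inner_self_eq_norm_sq]
        · intro o' _ hne
          exact (hortho o o' hne.symm).inner_eq (ht o) (ht o')
        · simp
      have h2 := real_inner_le_norm (t o) s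
      rw [h1, sq] at h2
      by_contra hlt
      have h3 := not_le.1 hlt
      nlinarith [norm_nonneg s]
    have hsum : inner ℝ (v - q) s = ∑ i : κ, inner ℝ v (t (some i)) := by
      rw [hst, inner_sum, Fintype.sum_option, hr _ (ht none), zero_add]
      refine Finset.sum_congr rfl fun i _ => ?_
      rw [inner_sub_left, (hortho none (some i) (by simp)).inner_eq hqm (ht _), sub_zero]
    rw [hsum, Finset.sum_mul]
    refine (Finset.abs_sum_le_sum_abs _ _).trans (Finset.sum_le_sum fun i _ => ?_)
    exact (hv i _ (ht _)).trans (mul_le_mul_of_nonneg_left (hle _) (hM i))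
  have hall : |inner ℝ (v - q) (v - q)| ≤ (∑ i, M i) * ‖v - q‖ := by
    have hcl : IsClosed {s : X | |inner ℝ (v - q) s| ≤ (∑ i, M i) * ‖s‖} :=
      isClosed_le (by fun_prop) (by fun_prop)
    have hmem : v - q ∈ (Submodule.span ℝ (range e)).topologicalClosure := by
      rw [hdense]; trivial
    exact closure_minimal (fun s hs => hbound s hs) hcl hmem
  rw [real_inner_self_eq_norm_sq, abs_of_nonneg (by positivity), sq] at hall
  by_contra hlt
  have h3 := not_le.1 hlt
  have : 0 ≤ ∑ i, M i := Finset.sum_nonneg fun i _ => hM i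
  nlinarith

/-! ### Legendre polynomials -/

/-- The derivative of order `m` of `((X - a)(b - X))^n`. -/
def rodrigues (a b : ℝ) (n m : ℕ) : Polynomial ℝ :=
  Polynomial.derivative^[m]
    (((Polynomial.X - Polynomial.C a) * (Polynomial.C b - Polynomial.X)) ^ n)

theorem iterate_derivative_rodrigues (a b : ℝ) (n m j : ℕ) :
    Polynomial.derivative^[j] (rodrigues a b n m) = rodrigues a b n (j + m) := by
  rw [rodrigues, rodrigues, Function.iterate_add_apply]

/-- Fewer than $n$ derivatives of an $n$-th power leave one factor of the base, so the result
vanishes at both end points. This removes the boundary terms later. -/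
theorem dvd_rodrigues (a b : ℝ) {n m : ℕ} (h : m < n) :
    (Polynomial.X - Polynomial.C a) * (Polynomial.C b - Polynomial.X) ∣ rodrigues a b n m :=
  (dvd_pow_self _ (by omega)).trans (Polynomial.pow_sub_dvd_iterate_derivative_pow _ n m)

/-- The Legendre polynomial of degree `n` on the interval `[a, b]`, up to normalization. -/
def legendre (a b : ℝ) (n : ℕ) : Polynomial ℝ := rodrigues a b n n

theorem degree_legendre (a b : ℝ) (n : ℕ) : (legendre a b n).degree = n := by
  have hq : ((Polynomial.X - Polynomial.C a) * (Polynomial.C b - Polynomial.X) :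
      Polynomial ℝ).natDegree = 2 := by
    compute_degree!
  have hl : ((((Polynomial.X - Polynomial.C a) * (Polynomial.C b - Polynomial.X) :
      Polynomial ℝ)) ^ n).natDegree = 2 * n := by
    rw [Polynomial.natDegree_pow, hq, mul_comm]
  have hq0 : ((Polynomial.X - Polynomial.C a) * (Polynomial.C b - Polynomial.X) :
      Polynomial ℝ) ≠ 0 := fun h => by simp [h] at hq
  have hle : (legendre a b n).natDegree ≤ n := by
    refine (Polynomial.natDegree_iterate_derivative _ _).trans ?_
    rw [hl]; omega
  -- The power has degree exactly $2n$; after $n$ derivatives its leading coefficient is multiplied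
  -- by a nonzero descending factorial and sits in degree $n$.
  have hc : (legendre a b n).coeff n ≠ 0 := by
    rw [legendre, rodrigues, Polynomial.coeff_iterate_derivative, ← two_mul, ← hl,
      Polynomial.coeff_natDegree, hl]
    refine smul_ne_zero ?_ (Polynomial.leadingCoeff_ne_zero.2 (pow_ne_zero n hq0))
    rw [Ne, Nat.descFactorial_eq_zero_iff_lt]
    omega
  refine le_antisymm (Polynomial.degree_le_of_natDegree_le hle)
    (Polynomial.le_degree_of_ne_zero hc)

theorem natDegree_legendre (a b : ℝ) (n : ℕ) : (legendre a b n).natDegree = n :=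
  Polynomial.natDegree_eq_of_degree_eq_some (degree_legendre a b n)

theorem span_legendre (a b : ℝ) : Submodule.span ℝ (range (legendre a b)) = ⊤ := by
  let S : Polynomial.Sequence ℝ := ⟨legendre a b, degree_legendre a b⟩
  exact S.span fun i => (Polynomial.leadingCoeff_ne_zero.2 (S.ne_zero i)).isUnit

/-- A polynomial in the variable `x_i`. -/
def inVar (i : Fin d) : Polynomial ℝ →ₐ[ℝ] MvPolynomial (Fin d) ℝ :=
  Polynomial.aeval (MvPolynomial.X i)

theorem pderiv_inVar_self (i : Fin d) (q : Polynomial ℝ) :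
    MvPolynomial.pderiv i (inVar i q) = inVar i (Polynomial.derivative q) := by
  rw [inVar, Derivation.map_aeval, MvPolynomial.pderiv_X_self, smul_eq_mul, mul_one]

theorem pderiv_inVar_of_ne {i j : Fin d} (h : j ≠ i) (q : Polynomial ℝ) :
    MvPolynomial.pderiv i (inVar j q) = 0 := by
  rw [inVar, Derivation.map_aeval, MvPolynomial.pderiv_X_of_ne h, smul_zero]

theorem degreeOf_inVar_of_ne {i j : Fin d} (h : j ≠ i) (q : Polynomial ℝ) :
    (inVar j q).degreeOf i = 0 := by
  rw [inVar, Polynomial.aeval_eq_sum_range]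
  refine Nat.le_zero.1 ((MvPolynomial.degreeOf_sum_le _ _ _).trans (Finset.sup_le fun m _ => ?_))
  rw [MvPolynomial.smul_eq_C_mul]
  refine (MvPolynomial.degreeOf_C_mul_le _ _ _).trans ?_
  rw [MvPolynomial.degreeOf_X_pow_of_ne _ h.symm]

theorem degreeOf_inVar_self_le (i : Fin d) (q : Polynomial ℝ) :
    (inVar i q).degreeOf i ≤ q.natDegree := by
  rw [inVar, Polynomial.aeval_eq_sum_range]
  refine (MvPolynomial.degreeOf_sum_le _ _ _).trans (Finset.sup_le fun m hm => ?_)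
  rw [MvPolynomial.smul_eq_C_mul]
  refine (MvPolynomial.degreeOf_C_mul_le _ _ _).trans ?_
  rw [MvPolynomial.degreeOf_X_self_pow]
  exact Nat.lt_succ_iff.1 (Finset.mem_range.1 hm)

/-- The iterated partial derivative `∂_i^k` of polynomials. -/
def iterPderiv (i : Fin d) (k : ℕ) : MvPolynomial (Fin d) ℝ →ₗ[ℝ] MvPolynomial (Fin d) ℝ :=
  (MvPolynomial.pderiv i).toLinearMap ^ k

theorem iterPderiv_zero (i : Fin d) (G : MvPolynomial (Fin d) ℝ) : iterPderiv i 0 G = G := rfl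

theorem iterPderiv_succ (i : Fin d) (k : ℕ) (G : MvPolynomial (Fin d) ℝ) :
    iterPderiv i (k + 1) G = iterPderiv i k (MvPolynomial.pderiv i G) := by
  rw [iterPderiv, pow_succ]; rfl

theorem iterPderiv_succ' (i : Fin d) (k : ℕ) (G : MvPolynomial (Fin d) ℝ) :
    iterPderiv i (k + 1) G = MvPolynomial.pderiv i (iterPderiv i k G) := by
  rw [iterPderiv, pow_succ']; rfl

theorem iterPderiv_inVar_mul (i : Fin d) (k : ℕ) (q : Polynomial ℝ)
    {R : MvPolynomial (Fin d) ℝ} (hR : MvPolynomial.pderiv i R = 0) :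
    iterPderiv i k (inVar i q * R) = inVar i (Polynomial.derivative^[k] q) * R := by
  induction k generalizing q with
  | zero => rfl
  | succ k ih =>
    rw [iterPderiv_succ, MvPolynomial.pderiv_mul, hR, mul_zero, add_zero, pderiv_inVar_self, ih,
      Function.iterate_succ_apply]

/-- The tensor product of the Legendre polynomials of degree `n_j` in the directions `j ∈ s`. -/
def Rect.tensor (K : Rect d) (s : Finset (Fin d)) (n : Fin d → ℕ) : MvPolynomial (Fin d) ℝ :=
  ∏ j ∈ s, inVar j (legendre (K.lo j) (K.hi j) (n j))

theorem Rect.pderiv_tensor_erase (K : Rect d) (i : Fin d) (n : Fin d → ℕ) :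
    MvPolynomial.pderiv i (K.tensor (Finset.univ.erase i) n) = 0 := by
  rw [Rect.tensor]
  refine Finset.prod_induction _ (fun q => MvPolynomial.pderiv i q = 0) ?_
    MvPolynomial.pderiv_one fun j hj => pderiv_inVar_of_ne (Finset.ne_of_mem_erase hj) _
  intro q r hq hr
  rw [MvPolynomial.pderiv_mul, hq, hr, zero_mul, mul_zero, add_zero]

theorem Rect.tensor_univ (K : Rect d) (i : Fin d) (n : Fin d → ℕ) :
    K.tensor Finset.univ n =
      inVar i (legendre (K.lo i) (K.hi i) (n i)) * K.tensor (Finset.univ.erase i) n :=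
  (Finset.mul_prod_erase _ _ (Finset.mem_univ i)).symm

/-- For `k ≤ n_i` the tensor Legendre polynomial is a `k`-th derivative, with primitives that
vanish on the faces orthogonal to `e_i`. -/
theorem Rect.exists_primitive_tensor (K : Rect d) (i : Fin d) {k : ℕ} (n : Fin d → ℕ)
    (hk : k ≤ n i) : ∃ G, iterPderiv i k G = K.tensor Finset.univ n ∧
      ∀ j < k, K.edge i ∣ iterPderiv i j G := by
  have hR := K.pderiv_tensor_erase i n
  -- The primitive stops Rodrigues' formula $k$ derivatives early in direction $i$. A further $j<k$
  -- derivatives give order $j+n_i-k<n_i$, so the edge factor survives.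
  refine ⟨inVar i (rodrigues (K.lo i) (K.hi i) (n i) (n i - k)) *
    K.tensor (Finset.univ.erase i) n, ?_, fun j hj => ?_⟩
  · rw [iterPderiv_inVar_mul i k _ hR, iterate_derivative_rodrigues, K.tensor_univ i, legendre,
      Nat.add_sub_cancel' hk]
  · rw [iterPderiv_inVar_mul i j _ hR, iterate_derivative_rodrigues]
    refine Dvd.dvd.mul_right ?_ _
    have h := map_dvd (inVar i) (dvd_rodrigues (K.lo i) (K.hi i) (n := n i)
      (m := j + (n i - k)) (by omega))
    convert h using 1
    simp [Rect.edge, inVar, ← MvPolynomial.algebraMap_eq]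

theorem Rect.iterPderiv_tensor_eq_zero (K : Rect d) (i : Fin d) {k : ℕ} (n : Fin d → ℕ)
    (hk : n i < k) : iterPderiv i k (K.tensor Finset.univ n) = 0 := by
  rw [K.tensor_univ i, iterPderiv_inVar_mul i k _ (K.pderiv_tensor_erase i n),
    Polynomial.iterate_derivative_eq_zero (by rwa [natDegree_legendre]), map_zero, zero_mul]

theorem Rect.degreeOf_tensor_le (K : Rect d) (n : Fin d → ℕ) (i : Fin d) :
    (K.tensor Finset.univ n).degreeOf i ≤ n i := by
  refine (MvPolynomial.degreeOf_prod_le _ _ _).trans ?_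
  rw [Finset.sum_eq_single i]
  · exact (degreeOf_inVar_self_le i _).trans (natDegree_legendre _ _ _).le
  · exact fun j _ hj => degreeOf_inVar_of_ne hj _
  · simp

/-- Induction on the set `s` of directions whose factor is still an arbitrary polynomial: linearity
in one factor and `span_legendre` remove one direction at a time. Monomials are an instance of `s =
univ`. -/
theorem Rect.span_tensor (K : Rect d) :
    Submodule.span ℝ (range (K.tensor Finset.univ)) = ⊤ := by
  set D := Submodule.span ℝ (range (K.tensor Finset.univ)) with hD
  have key : ∀ (s : Finset (Fin d)) (q : Fin d → Polynomial ℝ),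
      (∀ j ∉ s, ∃ n, q j = legendre (K.lo j) (K.hi j) n) → ∏ j, inVar j (q j) ∈ D := by
    intro s
    induction s using Finset.induction_on with
    | empty =>
      intro q hq
      choose n hn using fun j => hq j (Finset.notMem_empty j)
      refine Submodule.subset_span ⟨n, ?_⟩
      exact Finset.prod_congr rfl fun j _ => by rw [hn j]
    | insert i s hi ih =>
      intro q hq
      have hsplit : ∀ r : Polynomial ℝ, ∏ j, inVar j (Function.update q i r j) =
          inVar i r * ∏ j ∈ Finset.univ.erase i, inVar j (q j) := by
        intro r
        rw [← Finset.mul_prod_erase _ _ (Finset.mem_univ i), Function.update_self]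
        congr 1
        exact Finset.prod_congr rfl fun j hj => by
          rw [Function.update_of_ne (Finset.ne_of_mem_erase hj)]
      suffices h : ∀ r : Polynomial ℝ,
          inVar i r * ∏ j ∈ Finset.univ.erase i, inVar j (q j) ∈ D by
        rw [← Finset.mul_prod_erase _ _ (Finset.mem_univ i)]
        exact h _
      intro r
      have hr : r ∈ Submodule.span ℝ (range (legendre (K.lo i) (K.hi i))) := by
        rw [span_legendre]; trivial
      induction hr using Submodule.span_induction with
      | mem x hx =>
        obtain ⟨n, rfl⟩ := hx
        rw [← hsplit]
        refine ih _ fun j hj => ?_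
        by_cases hji : j = i
        · subst hji
          exact ⟨n, by rw [Function.update_self]⟩
        · rw [Function.update_of_ne hji]
          exact hq j (by simp [hji, hj])
      | zero => rw [map_zero, zero_mul]; exact zero_mem _
      | add x y _ _ hx hy => rw [map_add, add_mul]; exact add_mem hx hy
      | smul a x _ hx => rw [map_smul, smul_mul_assoc]; exact Submodule.smul_mem _ a hx
  rw [eq_top_iff]
  intro q _
  rw [q.as_sum]
  refine Submodule.sum_mem _ fun m _ => ?_
  rw [MvPolynomial.monomial_eq, ← MvPolynomial.smul_eq_C_mul]
  refine Submodule.smul_mem _ _ ?_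
  have := key Finset.univ (fun j => Polynomial.X ^ m j) (by simp)
  rw [Finsupp.prod_fintype _ _ (by simp)]
  simpa [inVar] using this

/-! ### Polynomial approximation on a rectangle -/

theorem inner_toLp_toLp {μ : Measure (Fin d → ℝ)} {f g : (Fin d → ℝ) → ℝ} (hf : MemLp f 2 μ)
    (hg : MemLp g 2 μ) : Inner.inner ℝ (hf.toLp f) (hg.toLp g) = ∫ x, f x * g x ∂μ := by
  rw [L2.inner_def]
  refine integral_congr_ae ?_
  filter_upwards [hf.coeFn_toLp, hg.coeFn_toLp] with x h1 h2
  rw [h1, h2, RCLike.inner_apply, conj_trivial, mul_comm]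

theorem norm_toLp_sq {μ : Measure (Fin d → ℝ)} {f : (Fin d → ℝ) → ℝ} (hf : MemLp f 2 μ) :
    ‖hf.toLp f‖ ^ 2 = ∫ x, f x ^ 2 ∂μ := by
  rw [← real_inner_self_eq_norm_sq, inner_toLp_toLp]
  simp only [sq]

theorem Rect.memLp_eval (K : Rect d) (q : MvPolynomial (Fin d) ℝ) :
    MemLp (fun x => MvPolynomial.eval x q) 2 (volume.restrict K.inner) :=
  K.memLp_of_continuous (MvPolynomial.continuous_eval q)

/-- Polynomials as elements of `L²(K)`. -/
def Rect.polyL2 (K : Rect d) : MvPolynomial (Fin d) ℝ →ₗ[ℝ] L2 K.inner where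
  toFun q := (K.memLp_eval q).toLp _
  map_add' q r := by
    rw [← MemLp.toLp_add]
    exact MemLp.toLp_congr _ _ (.of_forall fun x => by simp)
  map_smul' c q := by
    rw [RingHom.id_apply, ← MemLp.toLp_const_smul]
    exact MemLp.toLp_congr _ _ (.of_forall fun x => by simp)

theorem Rect.inner_toLp_polyL2 (K : Rect d) {f : (Fin d → ℝ) → ℝ}
    (hf : MemLp f 2 (volume.restrict K.inner)) (q : MvPolynomial (Fin d) ℝ) :
    Inner.inner ℝ (hf.toLp f) (K.polyL2 q) = ∫ x in K.inner, f x * MvPolynomial.eval x q :=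
  inner_toLp_toLp hf (K.memLp_eval q)

/-- The functions `v j` play the role of $\partial_i^jv$. Each of the $k$ integrations by parts
meets a polynomial divisible by the edge factor, so no trace of $v$ enters. -/
theorem integral_mul_iterPderiv {K : Rect d} {i : Fin d} {k : ℕ}
    {v : ℕ → (Fin d → ℝ) → ℝ} (hv : ∀ j, MemLp (v j) 2 (volume.restrict K.inner))
    (hw : ∀ j < k, IsWeakPDeriv K.inner i (v j) (v (j + 1))) {G : MvPolynomial (Fin d) ℝ}
    (hG : ∀ j < k, K.edge i ∣ iterPderiv i j G) :
    ∫ x in K.inner, v 0 x * MvPolynomial.eval x (iterPderiv i k G) =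
      (-1) ^ k * ∫ x in K.inner, v k x * MvPolynomial.eval x G := by
  induction k generalizing G with
  | zero => simp [iterPderiv_zero]
  | succ k ih =>
    obtain ⟨G', hG'⟩ := hG 0 (by omega)
    rw [iterPderiv_zero] at hG'
    rw [iterPderiv_succ, ih (fun j hj => hw j (by omega))
      (fun j hj => by rw [← iterPderiv_succ]; exact hG (j + 1) (by omega)), hG',
      (hw k (by omega)).integral_mul_pderiv_edge_mul ((hv _).integrable (by norm_num))
        ((hv _).integrable (by norm_num)), pow_succ]
    ring

/-- Poincaré inequality for polynomials that vanish on two opposite faces. -/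
theorem Rect.norm_polyL2_le (K : Rect d) (i : Fin d) {G : MvPolynomial (Fin d) ℝ}
    (hG : K.edge i ∣ G) :
    ‖K.polyL2 G‖ ≤ 2 * (K.hi i - K.lo i) * ‖K.polyL2 (MvPolynomial.pderiv i G)‖ := by
  set h := K.hi i - K.lo i with hh
  have h0 : 0 < h := sub_pos.2 (K.lt i)
  have hmeas : MeasurableSet K.inner := K.isOpen_inner.measurableSet
  set P := MvPolynomial.pderiv i G with hP
  have hint : ∀ q : MvPolynomial (Fin d) ℝ,
      Integrable (fun x => MvPolynomial.eval x q) (volume.restrict K.inner) := fun q =>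
    (K.memLp_eval q).integrable (by norm_num)
  have hweak : IsWeakPDeriv K.inner i (fun _ => (1 : ℝ)) (fun _ => 0) := by
    have := isWeakPDeriv_of_contDiff (U := K.inner) i (contDiff_const (c := (1 : ℝ)))
    convert this using 1
    funext x; simp [pderiv]
  -- The integrand is $\partial_i\big((x_i-a_i)G^2\big)$, whose primitive vanishes on both faces;
  -- this is integration by parts against the constant function $1$.
  have hzero : ∫ x in K.inner, MvPolynomial.eval x
      (G ^ 2 + 2 * ((MvPolynomial.X i - MvPolynomial.C (K.lo i)) * (G * P))) = 0 := by
    obtain ⟨G', hG'⟩ := hG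
    have := hweak.integral_mul_pderiv_edge_mul (integrable_const _) (integrable_const _)
      ((MvPolynomial.X i - MvPolynomial.C (K.lo i)) * (G' * G))
    simp only [one_mul, zero_mul, integral_zero, neg_zero] at this
    rw [← this]
    congr 1
    funext x
    congr 1
    have e : K.edge i * ((MvPolynomial.X i - MvPolynomial.C (K.lo i)) * (G' * G)) =
        (MvPolynomial.X i - MvPolynomial.C (K.lo i)) * (G * G) := by
      conv_rhs => rw [hG']
      rw [hG']; ring
    rw [e]
    simp only [MvPolynomial.pderiv_mul, map_sub, MvPolynomial.pderiv_X_self, MvPolynomial.pderiv_C,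
      sub_zero, ← hP]
    ring
  have hle : ∫ x in K.inner, (MvPolynomial.eval x G) ^ 2 ≤
      ∫ x in K.inner, (1 / 2 * MvPolynomial.eval x G ^ 2 +
        2 * h ^ 2 * MvPolynomial.eval x P ^ 2) := by
    have e : ∫ x in K.inner, (MvPolynomial.eval x G) ^ 2 = ∫ x in K.inner, MvPolynomial.eval x
        (-(2 * ((MvPolynomial.X i - MvPolynomial.C (K.lo i)) * (G * P)))) := by
      rw [← sub_eq_zero, ← hzero, ← integral_sub]
      · simp
      · exact (hint (G ^ 2)).congr (.of_forall fun x => by simp)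
      · exact hint _
    rw [e]
    refine setIntegral_mono_on (hint _) ?_ hmeas fun x hx => ?_
    · exact (hint (MvPolynomial.C (1 / 2) * G ^ 2 + MvPolynomial.C (2 * h ^ 2) * P ^ 2)).congr
        (.of_forall fun x => by simp)
    · have hx1 : 0 ≤ x i - K.lo i := by linarith [(hx i trivial).1]
      have hx2 : x i - K.lo i ≤ h := by linarith [(hx i trivial).2]
      simp only [map_neg, map_mul, map_sub, MvPolynomial.eval_X, MvPolynomial.eval_C, map_ofNat]
      set g := MvPolynomial.eval x G
      set p := MvPolynomial.eval x P
      set y := x i - K.lo i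
      have : y ^ 2 ≤ h ^ 2 := by gcongr
      -- Young's inequality $-2ygp\le\frac12g^2+2y^2p^2$ with $y\le h$; absorbing $\frac12\|G\|^2$
      -- produces the factor $2h$.
      nlinarith [sq_nonneg (g + 2 * y * p), mul_le_mul_of_nonneg_right this (sq_nonneg p)]
  have e1 : ∫ x in K.inner, (1 / 2 * MvPolynomial.eval x G ^ 2 +
        2 * h ^ 2 * MvPolynomial.eval x P ^ 2) =
      1 / 2 * ‖K.polyL2 G‖ ^ 2 + 2 * h ^ 2 * ‖K.polyL2 P‖ ^ 2 := by
    rw [integral_add, integral_const_mul, integral_const_mul]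
    · rw [← norm_toLp_sq (K.memLp_eval G), ← norm_toLp_sq (K.memLp_eval P)]
      rfl
    · exact (hint (MvPolynomial.C (1 / 2) * G ^ 2)).congr (.of_forall fun x => by simp)
    · exact (hint (MvPolynomial.C (2 * h ^ 2) * P ^ 2)).congr (.of_forall fun x => by simp)
  rw [e1, ← norm_toLp_sq (K.memLp_eval G)] at hle
  refine le_of_sq_le_sq ?_ (by positivity)
  change ‖K.polyL2 G‖ ^ 2 ≤ _ at hle
  nlinarith

theorem Rect.norm_polyL2_le_iterPderiv (K : Rect d) (i : Fin d) {k : ℕ}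
    {G : MvPolynomial (Fin d) ℝ} (hG : ∀ j < k, K.edge i ∣ iterPderiv i j G) :
    ‖K.polyL2 G‖ ≤ (2 * (K.hi i - K.lo i)) ^ k * ‖K.polyL2 (iterPderiv i k G)‖ := by
  have h0 : 0 < K.hi i - K.lo i := sub_pos.2 (K.lt i)
  induction k with
  | zero => simp [iterPderiv_zero]
  | succ k ih =>
    refine (ih fun j hj => hG j (by omega)).trans ?_
    rw [iterPderiv_succ', pow_succ, mul_assoc ((2 * (K.hi i - K.lo i)) ^ k)]
    exact mul_le_mul_of_nonneg_left (K.norm_polyL2_le i (hG k (by omega))) (by positivity)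

/-- If $m_i<n_i$, the second factor is an $n_i$-th derivative in direction $i$. Moving these
derivatives onto the first, which has degree $m_i$ in $x_i$, gives zero. -/
theorem Rect.inner_tensor_eq_zero (K : Rect d) {m n : Fin d → ℕ} (h : m ≠ n) :
    Inner.inner ℝ (K.polyL2 (K.tensor Finset.univ m)) (K.polyL2 (K.tensor Finset.univ n)) = 0 := by
  have key : ∀ (m n : Fin d → ℕ) (i : Fin d), m i < n i →
      Inner.inner ℝ (K.polyL2 (K.tensor Finset.univ m)) (K.polyL2 (K.tensor Finset.univ n)) = 0 := by
    intro m n i hi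
    obtain ⟨G, hGn, hG⟩ := K.exists_primitive_tensor i n le_rfl
    have := integral_mul_iterPderiv (K := K) (i := i) (k := n i)
      (v := fun j x => MvPolynomial.eval x (iterPderiv i j (K.tensor Finset.univ m)))
      (fun j => K.memLp_eval _)
      (fun j _ => by
        have := isWeakPDeriv_of_contDiff (U := K.inner) i
          (contDiff_eval (iterPderiv i j (K.tensor Finset.univ m)))
        rwa [pderiv_eval, ← iterPderiv_succ'] at this) hG
    rw [hGn, K.iterPderiv_tensor_eq_zero i m hi] at this
    rw [Rect.polyL2, LinearMap.coe_mk, AddHom.coe_mk, inner_toLp_toLp]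
    simpa [iterPderiv_zero] using this
  obtain ⟨i, hi⟩ := Function.ne_iff.1 h
  rcases lt_or_gt_of_ne hi with hlt | hlt
  · exact key m n i hlt
  · rw [real_inner_comm]; exact key n m i hlt

theorem Rect.exists_eval_near (K : Rect d) {g : (Fin d → ℝ) → ℝ} (hg : Continuous g) {ε : ℝ}
    (hε : 0 < ε) : ∃ q : MvPolynomial (Fin d) ℝ, ∀ x ∈ K.inner, |MvPolynomial.eval x q - g x| < ε := by
  let φ : MvPolynomial (Fin d) ℝ →ₐ[ℝ] C(Fin d → ℝ, ℝ) :=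
    MvPolynomial.aeval fun i => ⟨fun x => x i, continuous_apply i⟩
  have hφ : ∀ q x, φ q x = MvPolynomial.eval x q := by
    intro q x
    induction q using MvPolynomial.induction_on with
    | C a => simp [φ]
    | add q r hq hr => rw [map_add, ContinuousMap.add_apply, hq, hr, map_add]
    | mul_X q j hq => rw [map_mul, ContinuousMap.mul_apply, hq, map_mul]; simp [φ]
  have hsep : φ.range.SeparatesPoints := by
    intro x y hxy
    obtain ⟨i, hi⟩ := Function.ne_iff.1 hxy
    exact ⟨_, ⟨φ (MvPolynomial.X i), ⟨_, rfl⟩, rfl⟩, by simpa [hφ] using hi⟩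
  obtain ⟨_, ⟨q, rfl⟩, hq⟩ :=
    ContinuousMap.exists_mem_subalgebra_near_continuous_of_isCompact_of_separatesPoints hsep
      ⟨g, hg⟩ K.isCompact_closed hε
  refine ⟨q, fun x hx => ?_⟩
  rw [← hφ]
  exact hq x (K.inner_subset_closed hx)

theorem Rect.denseRange_polyL2 (K : Rect d) : DenseRange K.polyL2 := by
  intro f
  rw [Metric.mem_closure_range_iff]
  intro ε hε
  set μ := volume.restrict K.inner with hμ
  obtain ⟨g, hg⟩ := (BoundedContinuousFunction.toLp_denseRange (μ := μ) (p := 2)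
    (E := ℝ) (𝕜 := ℝ) (by norm_num)).exists_dist_lt f (half_pos hε)
  set c : ℝ := (measureUnivNNReal μ : ℝ) ^ ((2 : ENNReal).toReal)⁻¹ with hc
  have hc0 : 0 ≤ c := by positivity
  obtain ⟨q, hq⟩ := K.exists_eval_near g.continuous
    (show 0 < ε / 2 / (c + 1) by positivity)
  refine ⟨q, (dist_triangle _ (BoundedContinuousFunction.toLp 2 μ ℝ g) _).trans_lt ?_⟩
  have h2 : dist (BoundedContinuousFunction.toLp 2 μ ℝ g) (K.polyL2 q) ≤
      c * (ε / 2 / (c + 1)) := by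
    rw [dist_eq_norm]
    refine Lp.norm_le_of_ae_bound (by positivity) ?_
    have hin : ∀ᵐ x ∂μ, x ∈ K.inner := ae_restrict_mem K.isOpen_inner.measurableSet
    filter_upwards [Lp.coeFn_sub (BoundedContinuousFunction.toLp 2 μ ℝ g) (K.polyL2 q),
      BoundedContinuousFunction.coeFn_toLp 2 μ ℝ g, (K.memLp_eval q).coeFn_toLp, hin]
      with x h1 h2 h3 h4
    have h3' : K.polyL2 q x = MvPolynomial.eval x q := h3
    rw [h1, Pi.sub_apply, h2, h3', Real.norm_eq_abs, abs_sub_comm]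
    exact (hq x h4).le
  have h3 : c * (ε / 2 / (c + 1)) ≤ ε / 2 := by
    rw [mul_div_assoc', div_le_iff₀ (by positivity)]
    nlinarith
  linarith

theorem Rect.span_polyL2_tensor_dense (K : Rect d) :
    (Submodule.span ℝ (range fun n => K.polyL2 (K.tensor Finset.univ n))).topologicalClosure
      = ⊤ := by
  have e : Submodule.span ℝ (range fun n => K.polyL2 (K.tensor Finset.univ n)) =
      LinearMap.range K.polyL2 := by
    rw [range_comp' K.polyL2, Submodule.span_image, K.span_tensor, Submodule.map_top]
  rw [e, ← Submodule.dense_iff_topologicalClosure_eq_top]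
  exact K.denseRange_polyL2

/-- Every $s$ in this span is $\partial_i^kG$ with edge factors in all lower derivatives, a property
stable under linear combinations. Then $(v,s)=\pm(\partial_i^kv,G)$, and the Poincaré inequality
applied $k$ times controls $\|G\|$ by $\|s\|$. -/
theorem Rect.abs_inner_le_of_mem_span (K : Rect d) {i : Fin d} {k : ℕ}
    {v : ℕ → (Fin d → ℝ) → ℝ} (hv : ∀ j, MemLp (v j) 2 (volume.restrict K.inner))
    (hw : ∀ j < k, IsWeakPDeriv K.inner i (v j) (v (j + 1))) {s : L2 K.inner}
    (hs : s ∈ Submodule.span ℝ ((fun n => K.polyL2 (K.tensor Finset.univ n)) '' {n | k ≤ n i})) :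
    |Inner.inner ℝ ((hv 0).toLp _) s| ≤
      (2 * (K.hi i - K.lo i)) ^ k * ‖(hv k).toLp _‖ * ‖s‖ := by
  have hG : ∃ G, K.polyL2 (iterPderiv i k G) = s ∧ ∀ j < k, K.edge i ∣ iterPderiv i j G := by
    induction hs using Submodule.span_induction with
    | mem x hx =>
      obtain ⟨n, hn, rfl⟩ := hx
      obtain ⟨G, h1, h2⟩ := K.exists_primitive_tensor i n hn
      exact ⟨G, by rw [h1], h2⟩
    | zero => exact ⟨0, by simp, fun j _ => by simp⟩
    | add x y _ _ hx hy =>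
      obtain ⟨G, h1, h2⟩ := hx
      obtain ⟨G', h1', h2'⟩ := hy
      exact ⟨G + G', by rw [map_add, map_add, h1, h1'], fun j hj => by
        rw [map_add]; exact dvd_add (h2 j hj) (h2' j hj)⟩
    | smul a x _ hx =>
      obtain ⟨G, h1, h2⟩ := hx
      exact ⟨a • G, by rw [map_smul, map_smul, h1], fun j hj => by
        rw [map_smul, MvPolynomial.smul_eq_C_mul]; exact (h2 j hj).mul_left _⟩
  obtain ⟨G, rfl, hdvd⟩ := hG
  rw [K.inner_toLp_polyL2, integral_mul_iterPderiv hv hw hdvd, ← K.inner_toLp_polyL2 (hv k),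
    abs_mul, abs_pow, abs_neg, abs_one, one_pow, one_mul]
  refine (abs_real_inner_le_norm _ _).trans ?_
  have := mul_le_mul_of_nonneg_left (K.norm_polyL2_le_iterPderiv i hdvd)
    (norm_nonneg ((hv k).toLp _))
  linarith

/-- Bramble–Hilbert lemma on a rectangle with polynomials of partial degree at most `p`. -/
theorem Rect.exists_polynomial_integral_sq_sub_le (K : Rect d) (p : ℕ)
    {v : Fin d → ℕ → (Fin d → ℝ) → ℝ} {f : (Fin d → ℝ) → ℝ} (hf : ∀ i, v i 0 = f)
    (hf2 : MemLp f 2 (volume.restrict K.inner))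
    (hv : ∀ i j, MemLp (v i j) 2 (volume.restrict K.inner))
    (hw : ∀ i, ∀ j < p + 1, IsWeakPDeriv K.inner i (v i j) (v i (j + 1)))
    {h : ℝ} (hh : ∀ i, K.hi i - K.lo i ≤ h) :
    ∃ q : MvPolynomial (Fin d) ℝ, (∀ i, q.degreeOf i ≤ p) ∧
      ∫ x in K.inner, (f x - MvPolynomial.eval x q) ^ 2 ≤
        d * (2 * h) ^ (2 * (p + 1)) * ∑ i, ∫ x in K.inner, v i (p + 1) x ^ 2 := by
  classical
  -- Each index with some $n_i\ge p+1$ is assigned one such direction; `none` marks exactly the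
  -- indices with all $n_i\le p$.
  set c : (Fin d → ℕ) → Option (Fin d) := fun n =>
    if hn : ∃ i, p + 1 ≤ n i then some hn.choose else none with hc
  have hc1 : ∀ n i, c n = some i → p + 1 ≤ n i := by
    intro n i hn
    simp only [hc] at hn
    split_ifs at hn with hex
    · rw [← Option.some.inj hn]; exact hex.choose_spec
  have hc2 : ∀ n, c n = none → ∀ i, n i ≤ p := by
    intro n hn i
    by_contra hlt
    have hex : ∃ i, p + 1 ≤ n i := ⟨i, by omega⟩
    simp only [hc, dif_pos hex, reduceCtorEq] at hn
  have hfin : {n | c n = none}.Finite :=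
    (Set.finite_Iic (fun _ : Fin d => p)).subset fun n hn => hc2 n hn
  have h0 : ∀ i, 0 < K.hi i - K.lo i := fun i => sub_pos.2 (K.lt i)
  obtain ⟨q, hq, hle⟩ := exists_mem_span_norm_sub_le
    (fun n => K.polyL2 (K.tensor Finset.univ n)) (fun m n hmn => K.inner_tensor_eq_zero hmn)
    K.span_polyL2_tensor_dense c hfin (hf2.toLp f)
    (fun i => (2 * (K.hi i - K.lo i)) ^ (p + 1) * ‖(hv i (p + 1)).toLp _‖)
    (fun i s hs => by
      have hsub : {n | c n = some i} ⊆ {n | p + 1 ≤ n i} := fun n hn => hc1 n i hn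
      have hs' := Submodule.span_mono (image_mono hsub) hs
      have := K.abs_inner_le_of_mem_span (hv i) (hw i) hs'
      simpa only [hf i] using this)
    (fun i => mul_nonneg (pow_nonneg (by linarith [h0 i]) _) (norm_nonneg _))
  have hqp : ∃ Q : MvPolynomial (Fin d) ℝ, (∀ i, Q.degreeOf i ≤ p) ∧ K.polyL2 Q = q := by
    clear hle
    induction hq using Submodule.span_induction with
    | mem x hx =>
      obtain ⟨n, hn, rfl⟩ := hx
      exact ⟨_, fun i => (K.degreeOf_tensor_le n i).trans (hc2 n hn i), rfl⟩
    | zero => exact ⟨0, by simp, by simp⟩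
    | add x y _ _ hx hy =>
      obtain ⟨Q, h1, h2⟩ := hx
      obtain ⟨Q', h1', h2'⟩ := hy
      exact ⟨Q + Q', fun i => (MvPolynomial.degreeOf_add_le i _ _).trans (max_le (h1 i) (h1' i)),
        by rw [map_add, h2, h2']⟩
    | smul a x _ hx =>
      obtain ⟨Q, h1, h2⟩ := hx
      exact ⟨a • Q, fun i => by
        rw [MvPolynomial.smul_eq_C_mul]
        exact (MvPolynomial.degreeOf_C_mul_le _ _ _).trans (h1 i), by rw [map_smul, h2]⟩
  obtain ⟨Q, hQ, rfl⟩ := hqp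
  refine ⟨Q, hQ, ?_⟩
  have e : ∫ x in K.inner, (f x - MvPolynomial.eval x Q) ^ 2 =
      ‖hf2.toLp f - K.polyL2 Q‖ ^ 2 := by
    rw [Rect.polyL2, LinearMap.coe_mk, AddHom.coe_mk, ← MemLp.toLp_sub, norm_toLp_sq]
    rfl
  rw [e]
  calc _ ≤ (∑ i, (2 * (K.hi i - K.lo i)) ^ (p + 1) * ‖(hv i (p + 1)).toLp _‖) ^ 2 := by gcongr
    _ ≤ (∑ i, (2 * h) ^ (p + 1) * ‖(hv i (p + 1)).toLp _‖) ^ 2 := by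
      gcongr with i
      · exact Finset.sum_nonneg fun i _ =>
          mul_nonneg (pow_nonneg (by linarith [h0 i]) _) (norm_nonneg _)
      · linarith [h0 i]
      · exact hh i
    _ = (2 * h) ^ (2 * (p + 1)) * (∑ i, ‖(hv i (p + 1)).toLp _‖) ^ 2 := by
      rw [← Finset.mul_sum, mul_pow, ← pow_mul, mul_comm (p + 1) 2]
    _ ≤ (2 * h) ^ (2 * (p + 1)) * (d * ∑ i, ‖(hv i (p + 1)).toLp _‖ ^ 2) := by
      gcongr
      -- For $d=0$ nothing makes $h$ nonnegative, so the evenness of the exponent is used.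
      · exact (even_two_mul _).pow_nonneg _
      · simpa using sq_sum_le_card_mul_sum_sq (s := Finset.univ)
          (f := fun i => ‖(hv i (p + 1)).toLp _‖)
    _ = _ := by simp only [norm_toLp_sq]; ring

variable {Ω : Set (Fin d → ℝ)}

/-! ### Piecewise polynomial approximation -/

theorem RectMesh.ae_eq_biUnion_inner (𝒯 : RectMesh Ω) (hΩ : IsOpen Ω) :
    Ω =ᵐ[volume] (⋃ K ∈ 𝒯.elems, K.inner : Set (Fin d → ℝ)) := by
  have h1 : ∀ᵐ x ∂(volume.restrict Ω), x ∈ ⋃ K ∈ 𝒯.elems, K.inner := by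
    refine ae_of_forall_inner 𝒯 fun K hK => ?_
    filter_upwards [ae_restrict_mem K.isOpen_inner.measurableSet] with x hx
    exact mem_biUnion hK hx
  rw [ae_restrict_iff' hΩ.measurableSet] at h1
  refine Filter.EventuallyLE.antisymm h1 (Filter.Eventually.of_forall ?_)
  exact iUnion₂_subset 𝒯.inner_subset

theorem RectMesh.integral_eq_sum (𝒯 : RectMesh Ω) (hΩ : IsOpen Ω) {F : (Fin d → ℝ) → ℝ}
    (hF : Integrable F (volume.restrict Ω)) :
    ∫ x in Ω, F x = ∑ K ∈ 𝒯.elems, ∫ x in K.inner, F x := by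
  rw [setIntegral_congr_set (𝒯.ae_eq_biUnion_inner hΩ), integral_biUnion_finset]
  · exact fun K _ => K.isOpen_inner.measurableSet
  · exact fun K hK L hL hKL => 𝒯.disjoint K hK L hL hKL
  · exact fun K hK => IntegrableOn.mono_set hF (𝒯.inner_subset K hK)

theorem Rect.sub_le_diam (K : Rect d) (i : Fin d) : K.hi i - K.lo i ≤ K.diam := by
  refine Real.le_sqrt_of_sq_le ?_
  exact Finset.single_le_sum (f := fun i => (K.hi i - K.lo i) ^ 2) (fun _ _ => sq_nonneg _)
    (Finset.mem_univ i)

theorem RectMesh.diam_le_size (𝒯 : RectMesh Ω) {K : Rect d} (hK : K ∈ 𝒯.elems) :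
    K.diam ≤ 𝒯.size :=
  le_ciSup (f := fun K : 𝒯.elems => K.1.diam) (Set.finite_range _).bddAbove ⟨K, hK⟩

theorem RectMesh.size_nonneg (𝒯 : RectMesh Ω) : 0 ≤ 𝒯.size :=
  Real.iSup_nonneg fun _ => Real.sqrt_nonneg _

theorem RectMesh.restrict_inner (𝒯 : RectMesh Ω) {K : Rect d} (hK : K ∈ 𝒯.elems) :
    (volume.restrict Ω).restrict K.inner = volume.restrict K.inner := by
  rw [Measure.restrict_restrict K.isOpen_inner.measurableSet,
    inter_eq_left.2 (𝒯.inner_subset K hK)]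

/-- Functions in `L²` of the elements can be glued together. -/
theorem RectMesh.exists_glue (𝒯 : RectMesh Ω) (g : Rect d → (Fin d → ℝ) → ℝ)
    (hg : ∀ K ∈ 𝒯.elems, MemLp (g K) 2 (volume.restrict K.inner)) :
    ∃ q : L2 Ω, ∀ K ∈ 𝒯.elems, q =ᵐ[volume.restrict K.inner] g K := by
  have hmem : MemLp (fun x => ∑ K ∈ 𝒯.elems, K.inner.indicator (g K) x) 2
      (volume.restrict Ω) := by
    refine memLp_finsetSum _ fun K hK => ?_
    rw [memLp_indicator_iff_restrict K.isOpen_inner.measurableSet, 𝒯.restrict_inner hK]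
    exact hg K hK
  refine ⟨hmem.toLp _, fun K hK => ?_⟩
  filter_upwards [ae_restrict_subset (𝒯.inner_subset K hK) hmem.coeFn_toLp,
    ae_restrict_mem K.isOpen_inner.measurableSet] with x h1 h2
  rw [h1, Finset.sum_eq_single K, indicator_of_mem h2]
  · intro L hL hLK
    refine indicator_of_notMem (fun h => ?_) _
    exact disjoint_left.1 (𝒯.disjoint L hL K hK hLK) h h2
  · exact fun h => absurd hK h

theorem norm_sq_eq_integral (g : L2 Ω) : ‖g‖ ^ 2 = ∫ x in Ω, g x ^ 2 := by
  rw [← norm_toLp_sq (Lp.memLp g), Lp.toLp_coeFn]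

theorem inner_eq_integral (g h : L2 Ω) : inner ℝ g h = ∫ x in Ω, g x * h x := by
  rw [← inner_toLp_toLp (Lp.memLp g) (Lp.memLp h), Lp.toLp_coeFn, Lp.toLp_coeFn]

theorem RectMesh.norm_sq_eq_sum (𝒯 : RectMesh Ω) (hΩ : IsOpen Ω) (g : L2 Ω) :
    ‖g‖ ^ 2 = ∑ K ∈ 𝒯.elems, ∫ x in K.inner, g x ^ 2 := by
  rw [norm_sq_eq_integral, 𝒯.integral_eq_sum hΩ (Lp.memLp g).integrable_sq]

/-- In squared form the local estimates add up over the elements with no constant depending on their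
number. The family `v i j` holds only pure derivatives in direction $i$, taken elementwise; this
covers both the data in $H^k(\mathcal T_H)$ and functions in $H^1_0(\Omega)$. -/
theorem exists_mem_polySpace_norm_sub_sq_le (𝒯 : RectMesh Ω) (hΩ : IsOpen Ω) (p : ℕ)
    {v : Fin d → ℕ → L2 Ω} {f : L2 Ω} (hf : ∀ i, v i 0 = f)
    (hw : ∀ K ∈ 𝒯.elems, ∀ i, ∀ j < p + 1, IsWeakPDeriv K.inner i (v i j) (v i (j + 1))) :
    ∃ q ∈ polySpace 𝒯 p,
      ‖f - q‖ ^ 2 ≤ d * (2 * 𝒯.size) ^ (2 * (p + 1)) * ∑ i, ‖v i (p + 1)‖ ^ 2 := by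
  have hmem : ∀ K ∈ 𝒯.elems, ∀ g : L2 Ω, MemLp g 2 (volume.restrict K.inner) := fun K hK g =>
    (Lp.memLp g).mono_measure (Measure.restrict_mono (𝒯.inner_subset K hK) le_rfl)
  have hloc : ∀ K : Rect d, ∃ q : MvPolynomial (Fin d) ℝ, K ∈ 𝒯.elems → (∀ i, q.degreeOf i ≤ p) ∧
      ∫ x in K.inner, (f x - MvPolynomial.eval x q) ^ 2 ≤
        d * (2 * 𝒯.size) ^ (2 * (p + 1)) * ∑ i, ∫ x in K.inner, v i (p + 1) x ^ 2 := by
    intro K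
    by_cases hK : K ∈ 𝒯.elems
    · obtain ⟨q, hq⟩ := K.exists_polynomial_integral_sq_sub_le p
        (v := fun i j => (v i j : (Fin d → ℝ) → ℝ)) (f := f) (fun i => by rw [hf i])
        (hmem K hK f) (fun i j => hmem K hK _) (hw K hK)
        (fun i => (K.sub_le_diam i).trans (𝒯.diam_le_size hK))
      exact ⟨q, fun _ => hq⟩
    · exact ⟨0, fun h => absurd h hK⟩
  choose Q hQ using hloc
  obtain ⟨q, hq⟩ := 𝒯.exists_glue (fun K x => MvPolynomial.eval x (Q K))
    fun K _ => K.memLp_eval _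
  refine ⟨q, fun K hK => ⟨Q K, (hQ K hK).1, hq K hK⟩, ?_⟩
  simp only [𝒯.norm_sq_eq_sum hΩ]
  rw [Finset.sum_comm, Finset.mul_sum]
  refine Finset.sum_le_sum fun K hK => ?_
  refine le_trans (le_of_eq ?_) (hQ K hK).2
  refine integral_congr_ae ?_
  filter_upwards [hq K hK, ae_restrict_subset (𝒯.inner_subset K hK) (Lp.coeFn_sub f q)]
    with x h1 h2
  rw [h2, Pi.sub_apply, h1]

/-! ### Functions in `H¹₀(Ω)` -/

instance : CompleteSpace (H10 Ω) :=
  inferInstanceAs (CompleteSpace (testPairs Ω Ω).topologicalClosure)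

theorem H10.induction_on {P : GradPair Ω → Prop} (hP : IsClosed {w | P w})
    (htest : ∀ w ∈ testPairs Ω Ω, P w) (w : H10 Ω) : P w :=
  closure_minimal (fun w hw => htest w hw) hP w.2

theorem H10.isWeakPDeriv (hΩ : IsOpen Ω) {U : Set (Fin d → ℝ)} (hU : U ⊆ Ω) (i : Fin d)
    (w : H10 Ω) : IsWeakPDeriv U i (toL2 w) (grad i w) := by
  intro φ hφ
  have hc1 : Continuous (pderiv i φ) :=
    (hφ.smooth.continuous_fderiv (by simp)).clm_apply continuous_const
  have hz : ∀ x, x ∉ U → φ x = 0 := fun x hx =>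
    image_eq_zero_of_notMem_tsupport fun h => hx (hφ.supp h)
  have hz' : ∀ x, x ∉ U → pderiv i φ x = 0 := by
    intro x hx
    have : fderiv ℝ φ x = 0 := image_eq_zero_of_notMem_tsupport
      fun h => hx (hφ.supp (tsupport_fderiv_subset ℝ h))
    rw [pderiv, this]; rfl
  have hm : MemLp φ 2 (volume.restrict Ω) :=
    (hφ.smooth.continuous.memLp_of_hasCompactSupport hφ.compact).restrict _
  have hm' : MemLp (pderiv i φ) 2 (volume.restrict Ω) :=
    (hc1.memLp_of_hasCompactSupport (hφ.compact.fderiv_apply ℝ _)).restrict _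
  -- Both sides become inner products with fixed elements of $L^2(\Omega)$, hence are continuous in
  -- $w$, and the identity passes to the closure of the test functions.
  have e : ∀ (g : L2 Ω) (ψ : (Fin d → ℝ) → ℝ) (hψ : MemLp ψ 2 (volume.restrict Ω)),
      (∀ x, x ∉ U → ψ x = 0) → ∫ x in U, g x * ψ x = inner ℝ g (hψ.toLp ψ) := by
    intro g ψ hψ h0
    rw [← setIntegral_eq_of_subset_of_forall_sdiff_eq_zero hΩ.measurableSet hU
      (fun x hx => by rw [h0 x hx.2, mul_zero]), inner_eq_integral]
    refine integral_congr_ae ?_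
    filter_upwards [hψ.coeFn_toLp] with x hx
    rw [hx]
  refine H10.induction_on (P := fun w => (∫ x in U, w none x * pderiv i φ x) =
    -∫ x in U, w (some i) x * φ x) ?_ ?_ w
  · simp only [e _ _ hm' hz', e _ _ hm hz]
    exact isClosed_eq (by fun_prop) (by fun_prop)
  · rintro w ⟨η, hη, h0, h1⟩
    have := isWeakPDeriv_of_contDiff (U := U) i hη.smooth φ hφ
    rw [integral_congr_ae (g := fun x => η x * pderiv i φ x),
      integral_congr_ae (μ := volume.restrict U) (f := fun x => w (some i) x * φ x)
        (g := fun x => pderiv i η x * φ x), this]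
    · filter_upwards [ae_restrict_subset hU (h1 i)] with x hx
      rw [hx]
    · filter_upwards [ae_restrict_subset hU h0] with x hx
      rw [hx]

/-- The Friedrichs inequality. -/
theorem H10.norm_toL2_le {i : Fin d} {R : ℝ} (hR : ∀ x ∈ Ω, |x i| ≤ R) (hR0 : 0 ≤ R)
    (hΩ : IsOpen Ω) (w : H10 Ω) : ‖toL2 w‖ ≤ 2 * R * ‖grad i w‖ := by
  refine H10.induction_on (P := fun w => ‖w none‖ ≤ 2 * R * ‖w (some i)‖) ?_ ?_ w
  · exact isClosed_le (by fun_prop) (by fun_prop)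
  rintro w ⟨η, hη, h0, h1⟩
  have hpc : Continuous (pderiv i η) :=
    (hη.smooth.continuous_fderiv (by simp)).clm_apply continuous_const
  have hps : HasCompactSupport (pderiv i η) := hη.compact.fderiv_apply ℝ _
  have hxs : ContDiff ℝ ∞ fun x : Fin d → ℝ => x i := contDiff_apply ℝ ℝ i
  have hpd : ∀ x, pderiv i (fun x => x i * η x) x = η x + x i * pderiv i η x := by
    intro x
    have hX : HasFDerivAt (fun y : Fin d → ℝ => y i) (ContinuousLinearMap.proj i) x :=
      (ContinuousLinearMap.proj (R := ℝ) (φ := fun _ : Fin d => ℝ) i).hasFDerivAt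
    have hE : HasFDerivAt η (fderiv ℝ η x) x :=
      ((hη.smooth.differentiable (by simp)) x).hasFDerivAt
    rw [pderiv, (hX.fun_mul hE).fderiv]
    simp [pderiv]; ring
  -- Integrating $\partial_i(x_i\eta)$ against $\eta$ yields $\int\eta^2=-2\int
  -- x_i\,\eta\,\partial_i\eta$; Young's inequality with $|x_i|\le R$ then gives the factor $2R$.
  have hibp := isWeakPDeriv_of_contDiff (U := Ω) i (hxs.mul hη.smooth) η hη
  simp only [hpd] at hibp
  have i1 : Integrable (fun x => η x ^ 2) (volume.restrict Ω) :=
    ((hη.smooth.continuous.pow 2).integrable_of_hasCompactSupport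
      (by simpa only [sq] using! hη.compact.mul_left (f := η))).restrict
  have i2 : Integrable (fun x => x i * η x * pderiv i η x) (volume.restrict Ω) :=
    ((hxs.continuous.mul hη.smooth.continuous).mul hpc |>.integrable_of_hasCompactSupport
      hps.mul_left).restrict
  have i3 : Integrable (fun x => pderiv i η x ^ 2) (volume.restrict Ω) :=
    ((hpc.pow 2).integrable_of_hasCompactSupport
      (by simpa only [sq] using! hps.mul_left (f := pderiv i η))).restrict
  have e : ∫ x in Ω, η x ^ 2 = ∫ x in Ω, -2 * (x i * η x * pderiv i η x) := by
    have : ∫ x in Ω, (η x + x i * pderiv i η x) * η x =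
        (∫ x in Ω, η x ^ 2) + ∫ x in Ω, x i * η x * pderiv i η x := by
      rw [← integral_add i1 i2]
      congr 1; funext x; ring
    rw [this] at hibp
    rw [integral_const_mul]
    linarith
  have hle : ∫ x in Ω, η x ^ 2 ≤
      1 / 2 * (∫ x in Ω, η x ^ 2) + 2 * R ^ 2 * ∫ x in Ω, pderiv i η x ^ 2 := by
    rw [← integral_const_mul, ← integral_const_mul,
      ← integral_add (i1.const_mul _) (i3.const_mul _)]
    conv_lhs => rw [e]
    refine setIntegral_mono_on (i2.const_mul _) ((i1.const_mul _).add (i3.const_mul _))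
      hΩ.measurableSet fun x hx => ?_
    have hx1 : x i ^ 2 ≤ R ^ 2 := sq_le_sq' (abs_le.1 (hR x hx)).1 (abs_le.1 (hR x hx)).2
    nlinarith [sq_nonneg (η x + 2 * x i * pderiv i η x),
      mul_le_mul_of_nonneg_right hx1 (sq_nonneg (pderiv i η x))]
  have n0 : ‖w none‖ ^ 2 = ∫ x in Ω, η x ^ 2 := by
    rw [norm_sq_eq_integral]
    refine integral_congr_ae ?_
    filter_upwards [h0] with x hx
    rw [hx]
  have n1 : ‖w (some i)‖ ^ 2 = ∫ x in Ω, pderiv i η x ^ 2 := by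
    rw [norm_sq_eq_integral]
    refine integral_congr_ae ?_
    filter_upwards [h1 i] with x hx
    rw [hx]
  refine le_of_sq_le_sq ?_ (by positivity)
  rw [mul_pow, n0, n1]
  nlinarith

theorem gradNorm_sq (u : H10 Ω) : gradNorm u ^ 2 = ∑ i, ‖grad i u‖ ^ 2 :=
  Real.sq_sqrt (Finset.sum_nonneg fun _ _ => sq_nonneg _)

theorem norm_sq_H10 (u : H10 Ω) : ‖u‖ ^ 2 = ‖toL2 u‖ ^ 2 + gradNorm u ^ 2 := by
  rw [gradNorm_sq, Submodule.coe_norm, PiLp.norm_sq_eq_of_L2, Fintype.sum_option]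
  rfl

/-- This constant depends on the extent of $\Omega$. It serves existence and uniqueness only and
does not enter the error constant. -/
theorem exists_norm_sq_le_gradNorm_sq (hd : 0 < d) (hΩ : IsOpen Ω) (hb : Bornology.IsBounded Ω) :
    ∃ c : ℝ, 0 < c ∧ ∀ u : H10 Ω, c * ‖u‖ ^ 2 ≤ gradNorm u ^ 2 := by
  obtain ⟨R, hR⟩ := hb.exists_norm_le
  set R' := max R 0 with hR'
  have h0 : 0 ≤ R' := le_max_right _ _
  refine ⟨1 / ((2 * R') ^ 2 + 1), by positivity, fun u => ?_⟩
  have h1 := H10.norm_toL2_le (i := ⟨0, hd⟩) (R := R')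
    (fun x hx => ((norm_le_pi_norm x _).trans (hR x hx)).trans (le_max_left _ _)) h0 hΩ u
  have h2 : ‖grad ⟨0, hd⟩ u‖ ^ 2 ≤ gradNorm u ^ 2 := by
    rw [gradNorm_sq]
    exact Finset.single_le_sum (f := fun i => ‖grad i u‖ ^ 2) (fun _ _ => sq_nonneg _)
      (Finset.mem_univ _)
  have h3 : ‖toL2 u‖ ^ 2 ≤ (2 * R') ^ 2 * gradNorm u ^ 2 := by
    refine (pow_le_pow_left₀ (norm_nonneg _) h1 2).trans ?_
    rw [mul_pow]
    exact mul_le_mul_of_nonneg_left h2 (sq_nonneg _)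
  rw [one_div, inv_mul_le_iff₀ (by positivity), norm_sq_H10]
  linarith

/-- The Poincaré inequality for functions that are orthogonal to the piecewise constants. -/
theorem norm_toL2_le_of_orthogonal (𝒯 : RectMesh Ω) (hΩ : IsOpen Ω) (w : H10 Ω)
    (hw : ∀ q ∈ polySpace 𝒯 0, inner ℝ (toL2 w) q = 0) :
    ‖toL2 w‖ ≤ Real.sqrt d * (2 * 𝒯.size) * gradNorm w := by
  obtain ⟨q, hq, hle⟩ := exists_mem_polySpace_norm_sub_sq_le 𝒯 hΩ 0
    (v := fun i j => if j = 0 then toL2 w else grad i w) (f := toL2 w) (fun i => by simp)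
    (fun K hK i j hj => by
      obtain rfl : j = 0 := by omega
      simpa using! H10.isWeakPDeriv hΩ (𝒯.inner_subset K hK) i w)
  -- By orthogonality $\|w\|^2=(w,w-q)$.
  have h1 : ‖toL2 w‖ ≤ ‖toL2 w - q‖ := by
    have h2 := real_inner_le_norm (toL2 w) (toL2 w - q)
    rw [inner_sub_right, hw q hq, sub_zero, real_inner_self_eq_norm_sq, sq] at h2
    by_contra hlt
    have h3 := not_le.1 hlt
    nlinarith [norm_nonneg (toL2 w - q)]
  refine h1.trans (le_of_sq_le_sq (hle.trans (le_of_eq ?_)) ?_)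
  · simp only [zero_add, one_ne_zero, if_false]
    rw [mul_pow _ (gradNorm w), mul_pow (Real.sqrt d), Real.sq_sqrt (by positivity), gradNorm_sq]
  · exact mul_nonneg (mul_nonneg (Real.sqrt_nonneg _) (by linarith [𝒯.size_nonneg]))
      (Real.sqrt_nonneg _)

/-- The multi-index of the pure derivative of order `min j k` in direction `i`. -/
def MultiIdx.pure (k : ℕ) (i : Fin d) (j : ℕ) : MultiIdx d k :=
  ⟨fun l => if l = i then ⟨min j k, by omega⟩ else 0, by
    rw [Finset.sum_eq_single i] <;> simp +contextual⟩

theorem exists_mem_polySpace_norm_brokenToL2_sub_le (𝒯 : RectMesh Ω) (hΩ : IsOpen Ω) (p : ℕ)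
    (f : brokenSobolev 𝒯 (p + 1)) :
    ∃ q ∈ polySpace 𝒯 p, ‖brokenToL2 f - q‖ ≤ d * (2 * 𝒯.size) ^ (p + 1) * ‖f‖ := by
  obtain ⟨q, hq, hle⟩ := exists_mem_polySpace_norm_sub_sq_le 𝒯 hΩ p
    (v := fun i j => f.1 (MultiIdx.pure (p + 1) i j)) (f := brokenToL2 f)
    (fun i => by
      have e : MultiIdx.pure (p + 1) i 0 = MultiIdx.zero d (p + 1) :=
        Subtype.ext (funext fun l => by simp [MultiIdx.pure, MultiIdx.zero])
      rw [e]; rfl)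
    (fun K hK i j hj => f.2 K hK i _ _ fun l => by
      by_cases h : l = i
      · simp only [MultiIdx.pure, h, if_true]; omega
      · simp [MultiIdx.pure, h])
  refine ⟨q, hq, le_of_sq_le_sq (hle.trans ?_) ?_⟩
  · have h1 : ∑ i, ‖f.1 (MultiIdx.pure (p + 1) i (p + 1))‖ ^ 2 ≤ d * ‖f‖ ^ 2 := by
      refine (Finset.sum_le_card_nsmul Finset.univ _ (‖f‖ ^ 2) fun i _ => ?_).trans (by simp)
      exact pow_le_pow_left₀ (norm_nonneg _) (PiLp.norm_apply_le f.1 _) 2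
    calc _ ≤ d * (2 * 𝒯.size) ^ (2 * (p + 1)) * (d * ‖f‖ ^ 2) := by
          gcongr
          have := 𝒯.size_nonneg
          positivity
      _ = _ := by ring
  · have := 𝒯.size_nonneg
    positivity

/-! ### The bilinear form -/

theorem IsCoefficient.ae_norm_le {a₀ b₀ : ℝ} {A : (Fin d → ℝ) → ℝ}
    (hA : IsCoefficient Ω a₀ b₀ A) : ∀ᵐ x ∂(volume.restrict Ω), ‖A x‖ ≤ |a₀| + |b₀| := by
  filter_upwards [hA.bounds] with x hx
  rw [Real.norm_eq_abs, abs_le]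
  constructor
  · linarith [neg_abs_le a₀, abs_nonneg b₀]
  · linarith [le_abs_self b₀, abs_nonneg a₀]

theorem IsCoefficient.integrable_mul_mul {a₀ b₀ : ℝ} {A : (Fin d → ℝ) → ℝ}
    (hA : IsCoefficient Ω a₀ b₀ A) (g h : L2 Ω) :
    Integrable (fun x => A x * g x * h x) (volume.restrict Ω) := by
  refine MemLp.integrable_mul (p := 2) (q := 2) ?_ (Lp.memLp h)
  refine (Lp.memLp g).of_le_mul (c := |a₀| + |b₀|)
    (hA.measurable.mul (Lp.aestronglyMeasurable g)) ?_
  filter_upwards [hA.ae_norm_le] with x hx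
  rw [norm_mul]
  gcongr

/-- Multiplication by $A\mathbf 1_S$ is bounded on $L^2(\Omega)$, which makes `formOn` a continuous
bilinear form: for $S=\Omega$ the form $a$, for $S=K$ the right-hand side that defines $\mathcal
C_K$. -/
theorem IsCoefficient.exists_mul_operator {a₀ b₀ : ℝ} {A : (Fin d → ℝ) → ℝ}
    (hA : IsCoefficient Ω a₀ b₀ A) (hΩ : IsOpen Ω) {S : Set (Fin d → ℝ)} (hS : MeasurableSet S)
    (hSΩ : S ⊆ Ω) : ∃ T : L2 Ω →L[ℝ] L2 Ω, ∀ g h,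
      inner ℝ (T g) h = ∫ x in S, A x * g x * h x := by
  set M : ℝ := |a₀| + |b₀| with hM
  set A' : (Fin d → ℝ) → ℝ := S.indicator A with hA'
  have hm : AEStronglyMeasurable A' (volume.restrict Ω) := hA.measurable.indicator hS
  have hb : ∀ᵐ x ∂(volume.restrict Ω), ‖A' x‖ ≤ M := by
    filter_upwards [hA.ae_norm_le] with x hx
    exact (norm_indicator_le_norm_self A x).trans hx
  have hbg : ∀ g : L2 Ω, ∀ᵐ x ∂(volume.restrict Ω), ‖A' x * g x‖ ≤ M * ‖g x‖ := by
    intro g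
    filter_upwards [hb] with x hx
    rw [norm_mul]
    gcongr
  have hmem : ∀ g : L2 Ω, MemLp (fun x => A' x * g x) 2 (volume.restrict Ω) := fun g =>
    (Lp.memLp g).of_le_mul (hm.mul (Lp.aestronglyMeasurable g)) (hbg g)
  let T₀ : L2 Ω →ₗ[ℝ] L2 Ω :=
    { toFun := fun g => (hmem g).toLp _
      map_add' := fun g h => by
        rw [← MemLp.toLp_add]
        refine MemLp.toLp_congr _ _ ?_
        filter_upwards [Lp.coeFn_add g h] with x hx
        rw [hx, Pi.add_apply, Pi.add_apply, mul_add]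
      map_smul' := fun c g => by
        rw [RingHom.id_apply, ← MemLp.toLp_const_smul]
        refine MemLp.toLp_congr _ _ ?_
        filter_upwards [Lp.coeFn_smul c g] with x hx
        rw [hx, Pi.smul_apply, Pi.smul_apply, smul_eq_mul, smul_eq_mul, mul_left_comm] }
  refine ⟨T₀.mkContinuous M fun g => ?_, fun g h => ?_⟩
  · refine Lp.norm_le_mul_norm_of_ae_le_mul ?_
    filter_upwards [(hmem g).coeFn_toLp, hbg g] with x h1 h2
    change ‖(hmem g).toLp _ x‖ ≤ _
    rwa [h1]
  · have e : ∫ x in S, A x * g x * h x = ∫ x in S, A' x * g x * h x :=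
      setIntegral_congr_fun hS fun x hx => by simp only [hA', indicator_of_mem hx]
    rw [e, ← setIntegral_eq_of_subset_of_forall_sdiff_eq_zero hΩ.measurableSet hSΩ
        (fun x hx => by rw [hA', indicator_of_notMem hx.2, zero_mul, zero_mul]),
      LinearMap.mkContinuous_apply, inner_eq_integral]
    refine integral_congr_ae ?_
    filter_upwards [(hmem g).coeFn_toLp] with x hx
    change (hmem g).toLp _ x * h x = _
    rw [hx]

theorem IsCoefficient.exists_formOn_eq {a₀ b₀ : ℝ} {A : (Fin d → ℝ) → ℝ}
    (hA : IsCoefficient Ω a₀ b₀ A) (hΩ : IsOpen Ω) {S : Set (Fin d → ℝ)} (hS : MeasurableSet S)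
    (hSΩ : S ⊆ Ω) : ∃ a : H10 Ω →L[ℝ] H10 Ω →L[ℝ] ℝ, ∀ u v, a u v = formOn A S u v := by
  obtain ⟨T, hT⟩ := hA.exists_mul_operator hΩ hS hSΩ
  let D : Fin d → H10 Ω →L[ℝ] L2 Ω := fun i =>
    (PiLp.proj 2 (fun _ : Option (Fin d) => L2 Ω) (some i)).comp (sobolevZero Ω Ω).subtypeL
  let b : L2 Ω →L[ℝ] L2 Ω →L[ℝ] ℝ :=
    (isBoundedBilinearMap_inner (𝕜 := ℝ) (E := L2 Ω)).toContinuousLinearMap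
  refine ⟨∑ i, b.bilinearComp (T.comp (D i)) (D i), fun u v => ?_⟩
  rw [sum_apply, sum_apply, formOn]
  exact Finset.sum_congr rfl fun i _ => hT _ _

theorem form_comm (A : (Fin d → ℝ) → ℝ) (u v : H10 Ω) : form A u v = form A v u := by
  simp only [form, formOn]
  refine Finset.sum_congr rfl fun i _ => ?_
  congr 1; funext x; ring

theorem IsCoefficient.le_form_self {a₀ b₀ : ℝ} {A : (Fin d → ℝ) → ℝ}
    (hA : IsCoefficient Ω a₀ b₀ A) (u : H10 Ω) :
    a₀ * gradNorm u ^ 2 ≤ form A u u := by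
  rw [gradNorm_sq, Finset.mul_sum, form, formOn]
  refine Finset.sum_le_sum fun i _ => ?_
  set g := grad i u with hg
  rw [norm_sq_eq_integral, ← integral_const_mul]
  refine integral_mono_ae ((Lp.memLp g).integrable_sq.const_mul _) (hA.integrable_mul_mul g g) ?_
  filter_upwards [hA.bounds] with x hx
  nlinarith [mul_le_mul_of_nonneg_right hx.1 (sq_nonneg (g x))]

theorem sum_formOn {a₀ b₀ : ℝ} {A : (Fin d → ℝ) → ℝ} (hA : IsCoefficient Ω a₀ b₀ A)
    (hΩ : IsOpen Ω) (𝒯 : RectMesh Ω) (u v : H10 Ω) :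
    ∑ K ∈ 𝒯.elems, formOn A K.inner u v = form A u v := by
  simp only [form, formOn]
  rw [Finset.sum_comm]
  refine Finset.sum_congr rfl fun i _ => ?_
  rw [𝒯.integral_eq_sum hΩ (hA.integrable_mul_mul _ _)]

/-- The Lax–Milgram theorem on a closed subspace. -/
theorem exists_mem_forall_eq {H : Type*} [NormedAddCommGroup H] [InnerProductSpace ℝ H]
    [CompleteSpace H] (a : H →L[ℝ] H →L[ℝ] ℝ) {c : ℝ} (hc : 0 < c)
    (ha : ∀ u, c * ‖u‖ ^ 2 ≤ a u u) {W : Submodule ℝ H} (hW : IsClosed (W : Set H))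
    (F : StrongDual ℝ H) : ∃ e ∈ W, ∀ w ∈ W, a e w = F w := by
  have : CompleteSpace W := hW.completeSpace_coe
  let b : W →L[ℝ] W →L[ℝ] ℝ := a.bilinearComp W.subtypeL W.subtypeL
  have hb : IsCoercive b := ⟨c, hc, fun u => by
    have := ha u
    rw [sq, ← mul_assoc] at this
    exact this⟩
  let g : W := (InnerProductSpace.toDual ℝ W).symm (F.comp W.subtypeL)
  refine ⟨hb.continuousLinearEquivOfBilin.symm g, Subtype.mem _, fun w hw => ?_⟩
  have h1 := hb.continuousLinearEquivOfBilin_apply (hb.continuousLinearEquivOfBilin.symm g) ⟨w, hw⟩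
  rw [ContinuousLinearEquiv.apply_symm_apply, InnerProductSpace.toDual_symm_apply] at h1
  exact h1.symm

/-! ### The fine space and the multiscale space -/

/-- The space `W` as a subspace of `H¹₀(Ω)`. -/
def fineSubmodule (𝒯 : RectMesh Ω) (p : ℕ) : Submodule ℝ (H10 Ω) :=
  (((polySpace 𝒯 p).orthogonalProjectionOnto).comp toL2).ker

theorem isClosed_fineSubmodule (𝒯 : RectMesh Ω) (p : ℕ) :
    IsClosed (fineSubmodule 𝒯 p : Set (H10 Ω)) :=
  ContinuousLinearMap.isClosed_ker _

theorem mem_fineSubmodule {𝒯 : RectMesh Ω} {p : ℕ} {w : H10 Ω} :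
    w ∈ fineSubmodule 𝒯 p ↔ w ∈ fineSpace 𝒯 p := Iff.rfl

theorem mem_fineSpace_iff {𝒯 : RectMesh Ω} {p : ℕ} {w : H10 Ω} :
    w ∈ fineSpace 𝒯 p ↔ ∀ q ∈ polySpace 𝒯 p, inner ℝ (toL2 w) q = 0 := by
  change (polySpace 𝒯 p).orthogonalProjectionOnto (toL2 w) = 0 ↔ _
  rw [Submodule.orthogonalProjectionOnto_eq_zero_iff, Submodule.mem_orthogonal']

theorem polySpace_mono (𝒯 : RectMesh Ω) {p p' : ℕ} (h : p ≤ p') :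
    polySpace 𝒯 p ≤ polySpace 𝒯 p' := fun _ hv K hK => by
  obtain ⟨q, hq, hvq⟩ := hv K hK
  exact ⟨q, fun i => (hq i).trans h, hvq⟩

theorem coeFn_finset_sum {ι : Type*} (s : Finset ι) (g : ι → L2 Ω) :
    ∀ᵐ x ∂(volume.restrict Ω), (∑ i ∈ s, g i : L2 Ω) x = ∑ i ∈ s, g i x := by
  classical
  induction s using Finset.induction_on with
  | empty =>
    filter_upwards [Lp.coeFn_zero ℝ 2 (volume.restrict Ω)] with x hx
    simpa using hx
  | insert i s hi ih =>
    rw [Finset.sum_insert hi]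
    filter_upwards [ih, Lp.coeFn_add (g i) (∑ i ∈ s, g i)] with x h1 h2
    rw [h2, Pi.add_apply, h1, Finset.sum_insert hi]

/-- The defining property concerns $v$ supported in one element. A general $v\in V_H$ is the sum of
its restrictions to the elements, which again lie in $V_H$. -/
theorem IsBubbleOperator.inner_eq {𝒯 : RectMesh Ω} {p : ℕ} {B : polySpace 𝒯 p →ₗ[ℝ] H10 Ω}
    (hB : IsBubbleOperator 𝒯 p B) (v : polySpace 𝒯 p) {q : L2 Ω} (hq : q ∈ polySpace 𝒯 p) :
    inner ℝ (toL2 (B v)) q = inner ℝ (v : L2 Ω) q := by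
  classical
  have hpart : ∀ K : Rect d, ∃ vK : polySpace 𝒯 p, K ∈ 𝒯.elems → ∀ L ∈ 𝒯.elems,
      (vK : L2 Ω) =ᵐ[volume.restrict L.inner] if L = K then (v : L2 Ω) else 0 := by
    intro K
    obtain ⟨g, hg⟩ := 𝒯.exists_glue (fun L => if L = K then (v : L2 Ω) else 0) fun L hL => by
      split_ifs
      · exact (Lp.memLp (v : L2 Ω)).mono_measure
          (Measure.restrict_mono (𝒯.inner_subset L hL) le_rfl)
      · exact MemLp.zero
    refine ⟨⟨g, fun L hL => ?_⟩, fun _ => hg⟩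
    by_cases h : L = K
    · obtain ⟨Q, hQ, hvQ⟩ := v.2 L hL
      have := hg L hL
      rw [if_pos h] at this
      exact ⟨Q, hQ, this.trans hvQ⟩
    · have := hg L hL
      rw [if_neg h] at this
      exact ⟨0, by simp, this.trans (.of_forall fun x => by simp)⟩
  choose vK hvK using hpart
  have hsum : v = ∑ K ∈ 𝒯.elems, vK K := by
    apply Subtype.ext
    apply Lp.ext
    refine ae_of_forall_inner 𝒯 fun L hL => ?_
    have h1 : ∀ᵐ x ∂(volume.restrict L.inner), ∀ K ∈ 𝒯.elems,
        (vK K : L2 Ω) x = (if L = K then ((v : L2 Ω) : (Fin d → ℝ) → ℝ) else 0) x := by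
      rw [Filter.eventually_all_finset]
      exact fun K hK => hvK K hK L hL
    have h2 : ∀ᵐ x ∂(volume.restrict Ω), ((∑ K ∈ 𝒯.elems, vK K : polySpace 𝒯 p) : L2 Ω) x =
        ∑ K ∈ 𝒯.elems, (vK K : L2 Ω) x := by
      rw [Submodule.coe_sum]
      filter_upwards [coeFn_finset_sum 𝒯.elems fun K => (vK K : L2 Ω)] with x hx
      rw [hx]
    filter_upwards [h1, ae_restrict_subset (𝒯.inner_subset L hL) h2] with x h1 h2
    rw [h2, Finset.sum_congr rfl h1, Finset.sum_eq_single L]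
    · simp
    · exact fun K _ hK => by simp [hK.symm]
    · exact fun h => absurd hL h
  have hK : ∀ K ∈ 𝒯.elems, inner ℝ (toL2 (B (vK K))) q = inner ℝ (vK K : L2 Ω) q := by
    intro K hK
    refine ((hB K hK (vK K) fun L hL hLK => ?_).2 q hq)
    have := hvK K hK L hL
    rwa [if_neg hLK] at this
  rw [hsum, map_sum, map_sum, sum_inner, Submodule.coe_sum, sum_inner]
  exact Finset.sum_congr rfl hK

/-- The bubble part restores the moments changed by the quasi-interpolation: $\Pi\mathcal
Xv=\Pi\mathcal Iv+\Pi(v-\mathcal Iv)=\Pi v$. -/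
theorem IsBubbleOperator.inner_stabInterp {𝒯 : RectMesh Ω} {p : ℕ}
    {B : polySpace 𝒯 p →ₗ[ℝ] H10 Ω} (hB : IsBubbleOperator 𝒯 p B)
    (E : polySpace 𝒯 0 →ₗ[ℝ] affineZero 𝒯) (v : L2 Ω) {q : L2 Ω} (hq : q ∈ polySpace 𝒯 p) :
    inner ℝ (toL2 (stabInterp 𝒯 p E B v)) q = inner ℝ v q := by
  have h1 : ∀ v : L2 Ω, inner ℝ (polyProj 𝒯 p v : L2 Ω) q = inner ℝ v q := fun v =>
    Submodule.inner_orthogonalProjectionOnto_eq_of_mem_right ⟨q, hq⟩ v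
  rw [stabInterp, map_add, inner_add_left, hB.inner_eq _ hq, h1, inner_sub_left]
  ring

/-- Summing the element corrections gives $a(\mathcal Cv,w)=a(v,w)$ on $W$, hence one inclusion.
Conversely, for $z\perp_aW$ let $v=\mathcal X\Pi z$. It has the moments of $z$, so $z-(v-\mathcal
Cv)$ lies in $W$; it is also $a$-orthogonal to $W$, and coercivity makes it zero. -/
theorem mem_multiscaleSpace_iff {a₀ b₀ : ℝ} {A : (Fin d → ℝ) → ℝ}
    (hA : IsCoefficient Ω a₀ b₀ A) (hΩ : IsOpen Ω) {c : ℝ} (hc : 0 < c)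
    (hcoer : ∀ u : H10 Ω, c * ‖u‖ ^ 2 ≤ form A u u) (𝒯 : RectMesh Ω) (p : ℕ)
    (E : polySpace 𝒯 0 →ₗ[ℝ] affineZero 𝒯) {B : polySpace 𝒯 p →ₗ[ℝ] H10 Ω}
    (hB : IsBubbleOperator 𝒯 p B) (z : H10 Ω) :
    z ∈ multiscaleSpace 𝒯 p A E B ↔ ∀ w ∈ fineSpace 𝒯 p, form A z w = 0 := by
  obtain ⟨a, ha⟩ := hA.exists_formOn_eq hΩ hΩ.measurableSet le_rfl
  have haf : ∀ u v, form A u v = a u v := fun u v => (ha u v).symm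
  have hcorr : ∀ v c, IsCorrection 𝒯 p A v c →
      c ∈ fineSpace 𝒯 p ∧ ∀ w ∈ fineSpace 𝒯 p, form A (v - c) w = 0 := by
    rintro v _ ⟨cK, hcK, rfl⟩
    refine ⟨mem_fineSubmodule.1 (Submodule.sum_mem _ fun K hK => (hcK K hK).1), fun w hw => ?_⟩
    rw [haf, map_sub, sub_apply, map_sum, sum_apply, sub_eq_zero, ← haf,
      ← sum_formOn hA hΩ 𝒯]
    refine Finset.sum_congr rfl fun K hK => ?_
    rw [← haf, (hcK K hK).2 w hw]
  constructor
  · rintro ⟨v, -, c, hvc, rfl⟩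
    exact (hcorr v c hvc).2
  intro hz
  set v : H10 Ω := stabInterp 𝒯 p E B (polyProj 𝒯 p (toL2 z)) with hv
  have hex : ∀ K : Rect d, ∃ cK : H10 Ω, K ∈ 𝒯.elems → IsElementCorrection 𝒯 p A K v cK := by
    intro K
    by_cases hK : K ∈ 𝒯.elems
    · obtain ⟨aK, haK⟩ := hA.exists_formOn_eq hΩ K.isOpen_inner.measurableSet
        (𝒯.inner_subset K hK)
      obtain ⟨cK, h1, h2⟩ := exists_mem_forall_eq a hc (fun u => by rw [← haf]; exact hcoer u)
        (isClosed_fineSubmodule 𝒯 p) (aK v)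
      exact ⟨cK, fun _ => ⟨h1, fun w hw => by rw [haf, h2 w hw, haK]⟩⟩
    · exact ⟨0, fun h => absurd h hK⟩
  choose cK hcK using hex
  have hc' : IsCorrection 𝒯 p A v (∑ K ∈ 𝒯.elems, cK K) := ⟨cK, hcK, rfl⟩
  refine ⟨v, ⟨_, (polyProj 𝒯 p (toL2 z)).2, rfl⟩, _, hc', ?_⟩
  obtain ⟨h1, h2⟩ := hcorr _ _ hc'
  set y := ∑ K ∈ 𝒯.elems, cK K
  have hmem : z - (v - y) ∈ fineSpace 𝒯 p := by
    rw [mem_fineSpace_iff]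
    intro q hq
    have h3 : inner ℝ (polyProj 𝒯 p (toL2 z) : L2 Ω) q = inner ℝ (toL2 z) q :=
      Submodule.inner_orthogonalProjectionOnto_eq_of_mem_right ⟨q, hq⟩ (toL2 z)
    rw [map_sub, map_sub, inner_sub_left, inner_sub_left, mem_fineSpace_iff.1 h1 q hq, hv,
      hB.inner_stabInterp E _ hq, h3]
    ring
  have hzero : form A (z - (v - y)) (z - (v - y)) = 0 := by
    have e1 := hz _ hmem
    have e2 := h2 _ hmem
    rw [haf] at e1 e2 ⊢
    conv_lhs => rw [map_sub a]
    rw [sub_apply, e1, e2, sub_zero]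
  have h4 := hcoer (z - (v - y))
  rw [hzero] at h4
  have h5 : ‖z - (v - y)‖ ^ 2 ≤ 0 := by
    by_contra hlt
    nlinarith [not_le.1 hlt]
  exact sub_eq_zero.1 (norm_eq_zero.1 (pow_eq_zero_iff (two_ne_zero)|>.1
    (le_antisymm h5 (sq_nonneg _))))

end MultiscaleHeat

end

/-! ### Existence, uniqueness and the error estimate -/

open MultiscaleHeat in
theorem mainTheorem3 (d k p : ℕ) (hd : 0 < d) (hp : k = p + 1) (a₀ : ℝ) (ha₀ : 0 < a₀) :
    ∃ C : ℝ, 0 < C ∧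
      ∀ (Ω : Set (Fin d → ℝ)) (_ : IsOpen Ω) (_ : Bornology.IsBounded Ω)
        (T : ℝ) (_ : 0 < T)
        (b₀ : ℝ) (A : (Fin d → ℝ) → ℝ) (_ : IsCoefficient Ω a₀ b₀ A)
        (𝒯 : RectMesh Ω)
        (E : polySpace 𝒯 0 →ₗ[ℝ] affineZero 𝒯)
        (B : polySpace 𝒯 p →ₗ[ℝ] H10 Ω) (_ : IsBubbleOperator 𝒯 p B)
        (u₀ : H10 Ω) (f : ℝ → brokenSobolev 𝒯 k) (_ : ContinuousOn f (Set.Icc 0 T))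
        (u : ℝ → H10 Ω) (_ : IsWeakSolution A T u₀ (fun t => brokenToL2 (f t)) u),
        ∀ t ∈ Set.Icc 0 T,
          (∃! q, IsMultiscaleProj A (multiscaleSpace 𝒯 p A E B) (u t) q) ∧
          (∃! e, IsEnrichedCorrection 𝒯 p A (timeDeriv T u t) e) ∧
          ∀ q e, IsMultiscaleProj A (multiscaleSpace 𝒯 p A E B) (u t) q →
            IsEnrichedCorrection 𝒯 p A (timeDeriv T u t) e →
            gradNorm (u t - (q + e)) ≤ C * 𝒯.size ^ (p + 2) * ⨆ s : Set.Icc 0 T, ‖f s‖ := by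
  subst hp
  have hd' : (0 : ℝ) < d := Nat.cast_pos.2 hd
  -- The three factors come from coercivity, from the approximation of $f$ in $V_H$, and from the
  -- Poincaré inequality on $W$.
  refine ⟨a₀⁻¹ * (d * 2 ^ (p + 1)) * (Real.sqrt d * 2), by positivity, ?_⟩
  intro Ω hΩ hΩb T hT b₀ A hA 𝒯 E B hB u₀ f hf u hu t ht
  obtain ⟨a, ha⟩ := hA.exists_formOn_eq hΩ hΩ.measurableSet le_rfl
  have haf : ∀ u v, form A u v = a u v := fun u v => (ha u v).symm
  obtain ⟨c, hc, hcg⟩ := exists_norm_sq_le_gradNorm_sq hd hΩ hΩb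
  have hcoer : ∀ u : H10 Ω, a₀ * c * ‖u‖ ^ 2 ≤ form A u u := fun u => by
    rw [mul_assoc]
    exact (mul_le_mul_of_nonneg_left (hcg u) ha₀.le).trans (hA.le_form_self u)
  have hc' : 0 < a₀ * c := mul_pos ha₀ hc
  have hdef : ∀ z : H10 Ω, form A z z = 0 → z = 0 := fun z hz => by
    have h := hcoer z
    rw [hz] at h
    have : ‖z‖ ^ 2 ≤ 0 := by
      by_contra hlt
      nlinarith [not_le.1 hlt]
    exact norm_eq_zero.1 ((pow_eq_zero_iff two_ne_zero).1 (le_antisymm this (sq_nonneg _)))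
  have hform_sub : ∀ u v w, form A (u - v) w = form A u w - form A v w := fun u v w => by
    rw [haf, haf, haf, map_sub, sub_apply]
  have hV := mem_multiscaleSpace_iff hA hΩ hc' hcoer 𝒯 p E hB
  have hLM : ∀ F : HMinusOne Ω, ∃ e ∈ fineSpace 𝒯 p, ∀ w ∈ fineSpace 𝒯 p, form A e w = F w := by
    intro F
    simp only [haf] at hcoer ⊢
    exact exists_mem_forall_eq a hc' hcoer (isClosed_fineSubmodule 𝒯 p) F
  have hproj : ∃! q, IsMultiscaleProj A (multiscaleSpace 𝒯 p A E B) (u t) q := by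
    -- With $w$ the $a$-projection of $u(t)$ onto $W$, the remainder $u(t)-w$ is $a$-orthogonal to
    -- $W$ and is therefore the multiscale projection.
    obtain ⟨w, hw, hwu⟩ := hLM (a (u t))
    have hmem : u t - w ∈ multiscaleSpace 𝒯 p A E B := by
      rw [hV]
      intro z hz
      rw [hform_sub, hwu z hz, haf, sub_self]
    refine ⟨u t - w, ⟨hmem, fun z hz => ?_⟩, fun q hq => ?_⟩
    · rw [hform_sub, form_comm A w z, (hV z).1 hz w hw, sub_zero]
    · have hδ : q - (u t - w) ∈ multiscaleSpace 𝒯 p A E B := by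
        rw [hV]
        intro z hz
        rw [hform_sub, (hV _).1 hq.1 z hz, (hV _).1 hmem z hz, sub_zero]
      refine sub_eq_zero.1 (hdef _ ?_)
      rw [hform_sub, hq.2 _ hδ, hform_sub, form_comm A w, (hV _).1 hδ w hw, sub_zero, sub_self]
  have hfine : ∀ q, IsMultiscaleProj A (multiscaleSpace 𝒯 p A E B) (u t) q →
      u t - q ∈ fineSpace 𝒯 p := by
    intro q hq
    obtain ⟨w, hw, hwu⟩ := hLM (a (u t))
    have hmem : u t - w ∈ multiscaleSpace 𝒯 p A E B := by
      rw [hV]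
      intro z hz
      rw [hform_sub, hwu z hz, haf, sub_self]
    have : q = u t - w := hproj.unique hq ⟨hmem, fun z hz => by
      rw [hform_sub, form_comm A w z, (hV z).1 hz w hw, sub_zero]⟩
    rwa [this, sub_sub_cancel]
  have hcorr : ∃! e, IsEnrichedCorrection 𝒯 p A (timeDeriv T u t) e := by
    obtain ⟨e, he, hew⟩ := hLM (-timeDeriv T u t)
    refine ⟨e, ⟨he, fun w hw => hew w hw⟩, fun e' he' => ?_⟩
    have hδ : e' - e ∈ fineSpace 𝒯 p := (fineSubmodule 𝒯 p).sub_mem he'.1 he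
    refine sub_eq_zero.1 (hdef _ ?_)
    rw [hform_sub, he'.2 _ hδ, hew _ hδ]
    exact sub_self _
  refine ⟨hproj, hcorr, fun q e hq he => ?_⟩
  set z : H10 Ω := u t - (q + e) with hz
  have hzW : z ∈ fineSpace 𝒯 p := by
    rw [hz, ← sub_sub]
    exact (fineSubmodule 𝒯 p).sub_mem (hfine q hq) he.1
  have hortho := mem_fineSpace_iff.1 hzW
  -- Against $z\in W$ the multiscale part drops out, and $-a(\mathcal
  -- D(\partial_tu),z)=\langle\partial_tu,z\rangle$ completes the left-hand side of the equation.
  have heq : form A z z = inner ℝ (brokenToL2 (f t)) (toL2 z) := by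
    have h1 := hu.eqn t ht z
    have h2 : toDual (brokenToL2 (f t)) z = inner ℝ (brokenToL2 (f t)) (toL2 z) := rfl
    have h3 : form A z z = form A (u t) z - form A q z - form A e z := by
      have h4 : ∀ y, form A (u t - (q + e)) y = form A (u t) y - form A q y - form A e y :=
        fun y => by rw [← sub_sub, hform_sub, hform_sub]
      exact h4 z
    rw [h3, (hV q).1 hq.1 z hzW, he.2 z hzW, ← h2, ← h1]
    ring
  obtain ⟨r, hr, hfr⟩ := exists_mem_polySpace_norm_brokenToL2_sub_le 𝒯 hΩ p (f t)
  have hpoinc := norm_toL2_le_of_orthogonal 𝒯 hΩ z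
    fun q hq => hortho q (polySpace_mono 𝒯 (Nat.zero_le p) hq)
  -- Continuity on the compact interval bounds the family; for an unbounded family the real supremum
  -- would take the default value $0$.
  have hsup : ‖f t‖ ≤ ⨆ s : Set.Icc 0 T, ‖f s‖ := by
    have hbdd : BddAbove (Set.range fun s : Set.Icc 0 T => ‖f s‖) := by
      have := (isCompact_Icc.image_of_continuousOn hf.norm).bddAbove
      rwa [Set.image_eq_range] at this
    exact le_ciSup hbdd ⟨t, ht⟩
  set S := ⨆ s : Set.Icc 0 T, ‖f s‖ with hS
  have hH := 𝒯.size_nonneg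
  set H := 𝒯.size
  have hS0 : 0 ≤ S := (norm_nonneg _).trans hsup
  have hg0 : 0 ≤ gradNorm z := Real.sqrt_nonneg _
  have hle : a₀ * gradNorm z ^ 2 ≤
      (d * (2 * H) ^ (p + 1) * S) * (Real.sqrt d * (2 * H) * gradNorm z) := by
    refine (hA.le_form_self z).trans ?_
    -- Since $z\perp V_H$, the approximation $r$ can be subtracted from $f(t)$; this gains the power
    -- $H^{p+1}$.
    have h1 : inner ℝ (brokenToL2 (f t)) (toL2 z) =
        inner ℝ (brokenToL2 (f t) - r) (toL2 z) := by
      rw [inner_sub_left, real_inner_comm (toL2 z) r, hortho r hr, sub_zero]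
    rw [heq, h1]
    refine (real_inner_le_norm _ _).trans ?_
    gcongr
    exact hfr.trans (by gcongr)
  have hfin : a₀ * gradNorm z ≤ (d * (2 * H) ^ (p + 1) * S) * (Real.sqrt d * (2 * H)) := by
    -- One factor $\|\nabla z\|$ is cancelled, so the case where it vanishes is treated separately.
    rcases hg0.eq_or_lt with h0 | h0
    · rw [← h0, mul_zero]; positivity
    · refine le_of_mul_le_mul_right ?_ h0
      linarith
  calc gradNorm z = a₀⁻¹ * (a₀ * gradNorm z) := by rw [inv_mul_cancel_left₀ ha₀.ne']
    _ ≤ a₀⁻¹ * ((d * (2 * H) ^ (p + 1) * S) * (Real.sqrt d * (2 * H))) := by gcongr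
    _ = _ := by rw [mul_pow]; ring
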